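/- **Setting.** Let $\Sigma$ be a finite set of propositions. A timed word over $\Sigma$ is a nonempty finite sequence $\rho=(\sigma_1,\tau_1)\dots(\sigma_n,\tau_n)$ with $\emptyset\ne\sigma_i\subseteq\Sigma$ and $0=\tau_1\le\dots\le\tau_n$. Intervals are nonempty intervals of reals (open, half-open or closed); $\mathcal I_{\mathsf{int}}$ consists of those with endpoints in $\mathbb Z\cup\{\pm\infty\}$, and $\mathcal I_{\mathsf{nat}}$ of those contained in $[0,\infty)$ with endpoints in $\mathbb N\cup\{\infty\}$. **1-TPTL in negation normal form.** Formulae with one freeze variable $x$ are given by $$\varphi::=a\mid\neg a\mid\top\mid\bot\mid x.\varphi\mid T-x\in I\mid x-T\in I\mid\varphi\wedge\varphi\mid\varphi\vee\varphi\mid\varphi\,\mathsf U\,\varphi\mid\varphi\,\mathsf S\,\varphi\mid\Box\varphi\mid\boxminus\varphi\qquad(a\in\Sigma,\ I\in\mathcal I_{\mathsf{int}}),$$ with the strict pointwise semantics $\rho,i,\nu\models\varphi$, where $\nu\in\mathbb R$ is the value of $x$: $x.\varphi$ sets $x$ to $\tau_i$, $T-x\in I$ means $\tau_i-\nu\in I$,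 and $x-T\in I$ means $\nu-\tau_i\in I$. A formula is *simple* if it is $x.\psi$ with $\psi$ free of freeze quantifiers. $I_\nu$ denotes the finite set of intervals used in $\varphi$, where a constraint $x-T\in I$ is read as $T-x\in -I$. Intervals $I,I'$ are *non-adjacent* if $\sup I=\inf I'$ implies $\sup I=0$ and $\inf I=\sup I'$ implies $\inf I=0$; they are *positively* (resp. *negatively*) *non-adjacent* if the same holds with "$=0$" in the conclusions replaced by "$\le 0$" (resp. "$\ge0$"). $\varphi$ is positively (resp. negatively) non-adjacent if any two (possibly equal) intervals of constraints in the scope of the same freeze quantifier (with the same reading of $x-T\in I$) are. **PnEMTL.** Formulae are $$\alpha::=a\mid\alpha\wedge\alpha\mid\neg\alpha\mid\mathcal F^k_{I_1,\dots,I_k}(A_1,\dots,A_{k+1})(S)\mid\mathcal P^k_{I_1,\dots,I_k}(A_1,\dots,A_{k+1})(S),$$ where $k\ge1$ is the *arity*, $I_w\in\mathcal I_{\mathsf{nat}}$, $S$ is a finite set of PnEMTL formulae and the $A_w$ are finite nondeterministic automata over the alphabet $2^S$. Let $b_z\in 2^S$ be the set of formulae of $S$ that hold at position $z$. Then $\rho,i_0\models\mathcal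 F^k$ iff there are $i_0\le i_1\le\dots\le i_k\le n$ such that for $1\le w\le k$, $\tau_{i_w}-\tau_{i_0}\in I_w$ and $A_w$ accepts $b_{i_{w-1}+1}\cdots b_{i_w}$, and $A_{k+1}$ accepts $b_{i_k+1}\cdots b_n$ (segments may be empty). Symmetrically, $\rho,i_0\models\mathcal P^k$ iff there are $i_0\ge i_1\ge\dots\ge i_k\ge1$ such that for $1\le w\le k$, $\tau_{i_0}-\tau_{i_w}\in I_w$ and $A_w$ accepts $b_{i_{w-1}-1}b_{i_{w-1}-2}\cdots b_{i_w}$, and $A_{k+1}$ accepts $b_{i_k-1}\cdots b_1$. **Size.** $|\varphi|$ is the number of nodes of the syntax tree of $\varphi$. In $|\alpha|$, every atom and Boolean connective counts one, and a modality counts $1+k$, plus the sizes of the formulae in $S$, plus for each automaton the number of its states and of its transitions. **Theorem.** There is a polynomial $p$ such that for every finite $\Sigma$ and every simple 1-TPTL formula $\varphi$ in negation normal form with interval set $I_\nu$ there is a PnEMTL formula $\alpha$ such that: 1. $\alpha$ is equivalent to $\varphi$: for all timed words $\rho$, positions $i$ and values $\nu$, $\rho,i,\nu\models\varphi$ iff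 $\rho,i\models\alpha$. 2. $|\alpha|\le 2^{p(|\varphi|)}$, and every modality in $\alpha$ has arity at most $2|I_\nu|^2+1$. 3. Every interval of an $\mathcal F$ modality in $\alpha$, with left endpoint $l$ and right endpoint $u$, satisfies: $l=0$ or $l$ is the left endpoint of an interval of $I_\nu$; and $u=0$ or $u$ is the right endpoint of an interval of $I_\nu$. 4. Every interval of a $\mathcal P$ modality in $\alpha$, with left endpoint $l$ and right endpoint $u$, satisfies: $l=0$ or $-l$ is the right endpoint of an interval of $I_\nu$; and $u=0$ or $-u$ is the left endpoint of an interval of $I_\nu$. 5. If $\varphi$ is positively (resp. negatively) non-adjacent, then for every $\mathcal F$ (resp. $\mathcal P$) modality in $\alpha$, any two (possibly equal) of its intervals $I_1,\dots,I_k$ are non-adjacent. -/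

import Mathlib

namespace TimedLogic

universe u

/-! ## Time intervals -/

/-- A nonempty interval of reals (open, half-open or closed) whose endpoints
`inf I`, `sup I`, computed in `[-∞, ∞]`, lie in `ℤ ∪ {-∞, ∞}`. -/
@[ext]
structure IntInterval where
  carrier : Set ℝ
  nonempty : carrier.Nonempty
  ordConnected : carrier.OrdConnected
  inf_int : sInf (Real.toEReal '' carrier) = ⊥ ∨
    ∃ n : ℤ, sInf (Real.toEReal '' carrier) = ((n : ℝ) : EReal)
  sup_int : sSup (Real.toEReal '' carrier) = ⊤ ∨
    ∃ n : ℤ, sSup (Real.toEReal '' carrier) = ((n : ℝ) : EReal)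

/-- The infimum (left endpoint) of an interval, in `[-∞, ∞]`. -/
noncomputable def IntInterval.inf (I : IntInterval) : EReal :=
  sInf (Real.toEReal '' I.carrier)

/-- The supremum (right endpoint) of an interval, in `[-∞, ∞]`. -/
noncomputable def IntInterval.sup (I : IntInterval) : EReal :=
  sSup (Real.toEReal '' I.carrier)

/-- An interval with endpoints in `ℕ ∪ {∞}`: one of nonnegative reals. -/
structure NatInterval extends IntInterval where
  nonneg : ∀ t ∈ carrier, 0 ≤ t

theorem sInf_toEReal_neg (s : Set ℝ) :
    sInf (Real.toEReal '' (-s)) = -sSup (Real.toEReal '' s) := by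
  apply le_antisymm
  · rw [EReal.le_neg]
    apply sSup_le
    rintro _ ⟨t, ht, rfl⟩
    rw [EReal.le_neg]
    exact sInf_le ⟨-t, by simpa using ht, by simp⟩
  · apply le_sInf
    rintro _ ⟨t, ht, rfl⟩
    rw [EReal.neg_le]
    exact le_sSup ⟨-t, ht, by simp⟩

theorem sSup_toEReal_neg (s : Set ℝ) :
    sSup (Real.toEReal '' (-s)) = -sInf (Real.toEReal '' s) := by
  have h := sInf_toEReal_neg (-s)
  rw [neg_neg] at h
  rw [h, neg_neg]

/-- The reflected interval `-I = {-t | t ∈ I}`. -/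
def IntInterval.neg (I : IntInterval) : IntInterval where
  carrier := -I.carrier
  nonempty := I.nonempty.neg
  ordConnected := ⟨fun x hx y hy z hz =>
    I.ordConnected.out hy hx ⟨neg_le_neg hz.2, neg_le_neg hz.1⟩⟩
  inf_int := by
    rw [sInf_toEReal_neg]
    rcases I.sup_int with h | ⟨n, h⟩
    · left; rw [h]; rfl
    · right; exact ⟨-n, by rw [h]; simp⟩
  sup_int := by
    rw [sSup_toEReal_neg]
    rcases I.inf_int with h | ⟨n, h⟩
    · left; rw [h]; rfl
    · right; exact ⟨-n, by rw [h]; simp⟩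

/-- `I` and `I'` are non-adjacent. -/
def NonAdjacent (I I' : IntInterval) : Prop :=
  (I.sup = I'.inf → I.sup = 0) ∧ (I.inf = I'.sup → I.inf = 0)

/-- `I` and `I'` are positively non-adjacent. -/
def PosNonAdjacent (I I' : IntInterval) : Prop :=
  (I.sup = I'.inf → I.sup ≤ 0) ∧ (I.inf = I'.sup → I.inf ≤ 0)

/-- `I` and `I'` are negatively non-adjacent. -/
def NegNonAdjacent (I I' : IntInterval) : Prop :=
  (I.sup = I'.inf → 0 ≤ I.sup) ∧ (I.inf = I'.sup → 0 ≤ I.inf)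

/-! ## Finite timed words -/

/-- A nonempty finite timed word over the propositions `AP`; every letter is a nonempty set of
propositions, the time stamps are weakly increasing and start at `0`. -/
structure TimedWord (AP : Type u) where
  len : ℕ
  len_pos : 0 < len
  letter : Fin len → Set AP
  letter_nonempty : ∀ i, (letter i).Nonempty
  time : Fin len → ℝ
  time_zero : time ⟨0, len_pos⟩ = 0
  time_mono : Monotone time

/-! ## One-variable TPTL in negation normal form -/

/-- Formulae of 1-TPTL in negation normal form. -/
inductive TPTL (AP : Type u) : Type u
  | atom (a : AP)
  | natom (a : AP)
  | top
  | bot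
  /-- `x.φ` -/
  | freeze (φ : TPTL AP)
  /-- `T - x ∈ I` -/
  | diff (I : IntInterval)
  /-- `x - T ∈ I` -/
  | rdiff (I : IntInterval)
  | and (φ ψ : TPTL AP)
  | or (φ ψ : TPTL AP)
  | untl (φ ψ : TPTL AP)
  | snce (φ ψ : TPTL AP)
  /-- `□ φ`: at all strictly later positions -/
  | box (φ : TPTL AP)
  /-- `⊟ φ`: at all strictly earlier positions -/
  | pbox (φ : TPTL AP)

namespace TPTL

variable {AP : Type u}

/-- `ρ, i, ν ⊨ φ`, where `ν` is the value of the only freeze variable. -/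
def Sat (ρ : TimedWord AP) : TPTL AP → Fin ρ.len → ℝ → Prop
  | atom a, i, _ => a ∈ ρ.letter i
  | natom a, i, _ => a ∉ ρ.letter i
  | top, _, _ => True
  | bot, _, _ => False
  | freeze φ, i, _ => Sat ρ φ i (ρ.time i)
  | diff I, i, ν => ρ.time i - ν ∈ I.carrier
  | rdiff I, i, ν => ν - ρ.time i ∈ I.carrier
  | and φ ψ, i, ν => Sat ρ φ i ν ∧ Sat ρ ψ i ν
  | or φ ψ, i, ν => Sat ρ φ i ν ∨ Sat ρ ψ i ν
  | untl φ ψ, i, ν => ∃ j, i < j ∧ Sat ρ ψ j ν ∧ ∀ k, i < k → k < j → Sat ρ φ k ν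
  | snce φ ψ, i, ν => ∃ j, j < i ∧ Sat ρ ψ j ν ∧ ∀ k, j < k → k < i → Sat ρ φ k ν
  | box φ, i, ν => ∀ j, i < j → Sat ρ φ j ν
  | pbox φ, i, ν => ∀ j, j < i → Sat ρ φ j ν

/-- The size of a formula: the number of nodes of its syntax tree. -/
def size : TPTL AP → ℕ
  | atom _ | natom _ | top | bot | diff _ | rdiff _ => 1
  | freeze φ | box φ | pbox φ => size φ + 1
  | and φ ψ | or φ ψ | untl φ ψ | snce φ ψ => size φ + size ψ + 1

/-- The formula contains no freeze quantifier. -/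
def FreezeFree : TPTL AP → Prop
  | atom _ | natom _ | top | bot | diff _ | rdiff _ => True
  | freeze _ => False
  | box φ | pbox φ => FreezeFree φ
  | and φ ψ | or φ ψ | untl φ ψ | snce φ ψ => FreezeFree φ ∧ FreezeFree ψ

/-- A simple formula: `x.ψ` with `ψ` free of freeze quantifiers. -/
def IsSimple (φ : TPTL AP) : Prop := ∃ ψ : TPTL AP, φ = freeze ψ ∧ ψ.FreezeFree

/-- The set of intervals used in a formula; `x - T ∈ I` is read as `T - x ∈ -I`. -/
def intervals : TPTL AP → Set IntInterval
  | atom _ | natom _ | top | bot => ∅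
  | diff I => {I}
  | rdiff I => {I.neg}
  | freeze φ | box φ | pbox φ => intervals φ
  | and φ ψ | or φ ψ | untl φ ψ | snce φ ψ => intervals φ ∪ intervals ψ

theorem intervals_finite (φ : TPTL AP) : φ.intervals.Finite := by
  induction φ <;> simp_all [intervals]

/-- The intervals of the constraints that refer to the current value of the freeze variable,
i.e. that lie below no further freeze quantifier. -/
def scopeIntervals : TPTL AP → Set IntInterval
  | atom _ | natom _ | top | bot | freeze _ => ∅
  | diff I => {I}
  | rdiff I => {I.neg}
  | box φ | pbox φ => scopeIntervals φ
  | and φ ψ | or φ ψ | untl φ ψ | snce φ ψ => scopeIntervals φ ∪ scopeIntervals ψ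

/-- Any two intervals in the scope of the same freeze quantifier are related by `R`. -/
def ScopesRelated (R : IntInterval → IntInterval → Prop) : TPTL AP → Prop
  | atom _ | natom _ | top | bot | diff _ | rdiff _ => True
  | freeze φ => (∀ I ∈ scopeIntervals φ, ∀ I' ∈ scopeIntervals φ, R I I') ∧ ScopesRelated R φ
  | box φ | pbox φ => ScopesRelated R φ
  | and φ ψ | or φ ψ | untl φ ψ | snce φ ψ => ScopesRelated R φ ∧ ScopesRelated R ψ

/-- Positively non-adjacent formulae. -/
def IsPosNonAdjacent (φ : TPTL AP) : Prop := φ.ScopesRelated PosNonAdjacent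

/-- Negatively non-adjacent formulae. -/
def IsNegNonAdjacent (φ : TPTL AP) : Prop := φ.ScopesRelated NegNonAdjacent

end TPTL

/-! ## PnEMTL -/

/-- Formulae of PnEMTL. In the modalities of arity `k ≥ 1`, `S` lists the formulae of a finite set,
and `A 0, …, A k` are nondeterministic automata with finitely many states over the alphabet of all
subsets of that set. -/
inductive PnEMTL (AP : Type u) : Type u
  | atom (a : AP)
  | and (φ ψ : PnEMTL AP)
  | not (φ : PnEMTL AP)
  /-- the future modality with intervals `I 0, …, I (k - 1)` -/
  | fut (k : ℕ) (hk : 0 < k) (I : Fin k → NatInterval) (m : ℕ) (S : Fin m → PnEMTL AP)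
      (q : Fin (k + 1) → ℕ) (A : (w : Fin (k + 1)) → NFA (Set (Fin m)) (Fin (q w)))
  /-- the past modality with intervals `I 0, …, I (k - 1)` -/
  | past (k : ℕ) (hk : 0 < k) (I : Fin k → NatInterval) (m : ℕ) (S : Fin m → PnEMTL AP)
      (q : Fin (k + 1) → ℕ) (A : (w : Fin (k + 1)) → NFA (Set (Fin m)) (Fin (q w)))

/-- The word of the letters `b z` for the positions `z` with `P z`, in increasing order. -/
def segUp {n : ℕ} {β : Type*} (b : Fin n → β) (P : Fin n → Prop) [DecidablePred P] : List β :=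
  ((List.finRange n).filter (fun z => P z)).map b

/-- The word of the letters `b z` for the positions `z` with `P z`, in decreasing order. -/
def segDown {n : ℕ} {β : Type*} (b : Fin n → β) (P : Fin n → Prop) [DecidablePred P] : List β :=
  (segUp b P).reverse

/-- The size of a finite automaton: its number of states plus its number of transitions. -/
noncomputable def nfaSize {α : Type*} {n : ℕ} (M : NFA α (Fin n)) : ℕ :=
  n + {t : Fin n × α × Fin n | t.2.2 ∈ M.step t.1 t.2.1}.ncard

namespace PnEMTL

variable {AP : Type u}

/-- `ρ, i ⊨ φ`. The letter read at a position `z` is the set of those formulae of `S` which hold at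
`z`; the positions `p 0 = i, p 1, …, p k` cut the rest of the word into `k + 1` segments. -/
def Sat (ρ : TimedWord AP) : PnEMTL AP → Fin ρ.len → Prop
  | atom a, i => a ∈ ρ.letter i
  | and φ ψ, i => Sat ρ φ i ∧ Sat ρ ψ i
  | not φ, i => ¬ Sat ρ φ i
  | fut k _ I m S _ A, i =>
      ∃ p : Fin (k + 1) → Fin ρ.len, p 0 = i ∧ Monotone p ∧
        (∀ w : Fin k, ρ.time (p w.succ) - ρ.time i ∈ (I w).carrier ∧
          segUp (fun z => {s : Fin m | Sat ρ (S s) z}) (fun z => p w.castSucc < z ∧ z ≤ p w.succ)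
            ∈ (A w.castSucc).accepts) ∧
        segUp (fun z => {s : Fin m | Sat ρ (S s) z}) (fun z => p (Fin.last k) < z)
          ∈ (A (Fin.last k)).accepts
  | past k _ I m S _ A, i =>
      ∃ p : Fin (k + 1) → Fin ρ.len, p 0 = i ∧ Antitone p ∧
        (∀ w : Fin k, ρ.time i - ρ.time (p w.succ) ∈ (I w).carrier ∧
          segDown (fun z => {s : Fin m | Sat ρ (S s) z}) (fun z => p w.succ ≤ z ∧ z < p w.castSucc)
            ∈ (A w.castSucc).accepts) ∧
        segDown (fun z => {s : Fin m | Sat ρ (S s) z}) (fun z => z < p (Fin.last k))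
          ∈ (A (Fin.last k)).accepts

/-- The size of a formula; a modality counts one, plus its arity, plus the sizes of the formulae in
`S` and of its automata. -/
noncomputable def size : PnEMTL AP → ℕ
  | atom _ => 1
  | and φ ψ => size φ + size ψ + 1
  | not φ => size φ + 1
  | fut k _ _ _ S _ A | past k _ _ _ S _ A =>
      1 + k + ∑ s, size (S s) + ∑ w, nfaSize (A w)

/-- Every future modality in the formula (at any depth) has arity and intervals satisfying `F`, and
every past modality has arity and intervals satisfying `P`. -/
def AllModalities (F P : (k : ℕ) → (Fin k → NatInterval) → Prop) : PnEMTL AP → Prop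
  | atom _ => True
  | and φ ψ => AllModalities F P φ ∧ AllModalities F P ψ
  | not φ => AllModalities F P φ
  | fut k _ I _ S _ _ => F k I ∧ ∀ s, AllModalities F P (S s)
  | past k _ I _ S _ _ => P k I ∧ ∀ s, AllModalities F P (S s)

/-- All modalities have arity at most `K`. -/
def ArityLE (K : ℕ) (α : PnEMTL AP) : Prop :=
  α.AllModalities (fun k _ => k ≤ K) (fun k _ => k ≤ K)

/-- Every interval of a future modality satisfies `R`. -/
def FutIntervals (R : NatInterval → Prop) (α : PnEMTL AP) : Prop :=
  α.AllModalities (fun _ I => ∀ w, R (I w)) (fun _ _ => True)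

/-- Every interval of a past modality satisfies `R`. -/
def PastIntervals (R : NatInterval → Prop) (α : PnEMTL AP) : Prop :=
  α.AllModalities (fun _ _ => True) (fun _ I => ∀ w, R (I w))

/-- Positively non-adjacent formulae: the interval set of each future modality is non-adjacent. -/
def IsPosNonAdjacent (α : PnEMTL AP) : Prop :=
  α.AllModalities
    (fun _ I => ∀ w w', NonAdjacent (I w).toIntInterval (I w').toIntInterval) (fun _ _ => True)

/-- Negatively non-adjacent formulae: the interval set of each past modality is non-adjacent. -/
def IsNegNonAdjacent (α : PnEMTL AP) : Prop :=
  α.AllModalities (fun _ _ => True)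
    (fun _ I => ∀ w w', NonAdjacent (I w).toIntInterval (I w').toIntInterval)

end PnEMTL

end TimedLogic

/-!
A simple formula `x.θ` is translated by guessing a labelling of the positions by sets of subformulae
of `θ`. Since `θ` is in negation normal form, it suffices that the asserted atoms and constraints
are true and that the labels respect the unfolding rules of the connectives; then every asserted
formula is true (`TPTL.sat_of_hintikka`), and conversely the true subformulae form such a labelling.
The translation is the disjunction, over the possible labels and letters of the current position
`i`, of a formula on the letter, a future modality formula and a past modality formula. The last two
say that the label extends to a labelling to the right and to the left; they meet only at `i`.

The untimed conditions are regular, so the issue is to verify the asserted time constraints with few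
intervals. A constraint `T - x ∈ I` holds on a convex set of positions. As cut points of the future
modality take, for each `I`, the first and the last position after `i` at which it holds: at most
twice as many as there are intervals (`RunSpec.ncard_cutSet_le`). Their labels are part of the
guess, and the interval of a cut point is the nonnegative part of the intersection of all intervals
claimed there. Between two cut points the automaton lets a label claim only intervals claimed at
both ends, and nothing after the last one. This is sound by convexity
(`RunSpec.exists_run_of_sat_cutFormula`), and complete because a constraint true strictly between
two consecutive cut points is true at both (`RunSpec.exists_sat_cutFormula`). One more cut point, at
`i` itself, keeps the arity positive.

The endpoints of such an intersection are `0` or endpoints of intervals of the formula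
(`endpointsIn_common`), so positive non-adjacency passes to non-adjacency of the intervals used
(`EndpointsIn.nonAdjacent`). The statements on the past follow by reversing the timed word and
reflecting the intervals (`PnEMTL.sat_mirror`). There are at most `2 ^ |θ|` labels, hence
exponentially many states, letters and guesses.
-/

namespace TimedLogic

universe u v

/-! ### Endpoints of finite intersections -/

/-- The nonnegative reals lying in every interval of `E`. -/
def commonPart (E : Set IntInterval) : Set ℝ := {t | 0 ≤ t ∧ ∀ I ∈ E, t ∈ I.carrier}

theorem commonPart_ordConnected (E : Set IntInterval) : (commonPart E).OrdConnected :=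
  ⟨fun _ hx _ hy _ hz => ⟨hx.1.trans hz.1, fun I hI =>
    I.ordConnected.out (hx.2 I hI) (hy.2 I hI) hz⟩⟩

theorem commonPart_subset {E : Set IntInterval} {I : IntInterval} (hI : I ∈ E) :
    commonPart E ⊆ I.carrier := fun _ ht => ht.2 I hI

theorem IntInterval.exists_gt {I : IntInterval} {r : ℝ} (h : (r : EReal) < I.sup) :
    ∃ t ∈ I.carrier, r < t := by
  obtain ⟨_, ⟨t, ht, rfl⟩, h⟩ := lt_sSup_iff.1 h
  exact ⟨t, ht, by exact_mod_cast h⟩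

theorem IntInterval.exists_lt {I : IntInterval} {r : ℝ} (h : I.inf < (r : EReal)) :
    ∃ t ∈ I.carrier, t < r := by
  obtain ⟨_, ⟨t, ht, rfl⟩, h⟩ := sInf_lt_iff.1 h
  exact ⟨t, ht, by exact_mod_cast h⟩

theorem exists_sup_commonPart {E : Set IntInterval} (hE : E.Finite) (hne : E.Nonempty)
    (hc : (commonPart E).Nonempty) :
    ∃ I ∈ E, sSup (Real.toEReal '' commonPart E) = I.sup := by
  obtain ⟨I, hI, hmin⟩ := Set.exists_min_image E IntInterval.sup hE hne
  obtain ⟨c, hc⟩ := hc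
  refine ⟨I, hI, le_antisymm (sSup_le_sSup (Set.image_mono (commonPart_subset hI))) ?_⟩
  refine le_of_forall_lt fun x hx => ?_
  obtain ⟨r, hxr, hr⟩ := EReal.lt_iff_exists_real_btwn.1 hx
  have hmem : max c r ∈ commonPart E := by
    refine ⟨le_max_of_le_left hc.1, fun I' hI' => ?_⟩
    obtain ⟨t, ht, hrt⟩ := IntInterval.exists_gt (hr.trans_le (hmin I' hI'))
    rcases le_total c r with h | h
    · rw [max_eq_right h]
      exact I'.ordConnected.out (hc.2 I' hI') ht ⟨h, hrt.le⟩
    · rw [max_eq_left h]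
      exact hc.2 I' hI'
  calc x < r := hxr
    _ ≤ ((max c r : ℝ) : EReal) := by exact_mod_cast le_max_right c r
    _ ≤ _ := le_sSup (Set.mem_image_of_mem _ hmem)

theorem exists_inf_commonPart {E : Set IntInterval} (hE : E.Finite) (hne : E.Nonempty)
    (hc : (commonPart E).Nonempty) :
    sInf (Real.toEReal '' commonPart E) = 0 ∨
      ∃ I ∈ E, sInf (Real.toEReal '' commonPart E) = I.inf := by
  obtain ⟨I, hI, hmax⟩ := Set.exists_max_image E IntInterval.inf hE hne
  obtain ⟨c, hc⟩ := hc
  have key : sInf (Real.toEReal '' commonPart E) = max 0 I.inf := by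
    apply le_antisymm
    · refine le_of_forall_gt fun x hx => ?_
      obtain ⟨r, hr, hrx⟩ := EReal.lt_iff_exists_real_btwn.1 hx
      obtain ⟨h0, hr⟩ := max_lt_iff.1 hr
      have h0 : 0 < r := by exact_mod_cast h0
      have hmem : min c r ∈ commonPart E := by
        refine ⟨le_min hc.1 h0.le, fun I' hI' => ?_⟩
        obtain ⟨t, ht, hrt⟩ := IntInterval.exists_lt ((hmax I' hI').trans_lt hr)
        rcases le_total c r with h | h
        · rw [min_eq_left h]
          exact hc.2 I' hI'
        · rw [min_eq_right h]
          exact I'.ordConnected.out ht (hc.2 I' hI') ⟨hrt.le, h⟩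
      calc _ ≤ ((min c r : ℝ) : EReal) := sInf_le (Set.mem_image_of_mem _ hmem)
        _ ≤ r := by exact_mod_cast min_le_right c r
        _ < x := hrx
    · refine max_le (le_sInf ?_) (sInf_le_sInf (Set.image_mono (commonPart_subset hI)))
      rintro _ ⟨t, ht, rfl⟩
      exact_mod_cast ht.1
  rcases le_total I.inf 0 with h | h
  · left; rw [key, max_eq_left h]
  · right; exact ⟨I, hI, by rw [key, max_eq_right h]⟩

/-- The nonnegative part of the intersection of a finite nonempty family of intervals. -/
def NatInterval.common (E : Set IntInterval) (hE : E.Finite) (hne : E.Nonempty)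
    (hc : (commonPart E).Nonempty) : NatInterval where
  carrier := commonPart E
  nonempty := hc
  ordConnected := commonPart_ordConnected E
  inf_int := by
    rcases exists_inf_commonPart hE hne hc with h | ⟨I, -, h⟩
    · right; exact ⟨0, by rw [h]; simp⟩
    · rw [h]; exact I.inf_int
  sup_int := by
    obtain ⟨I, -, h⟩ := exists_sup_commonPart hE hne hc
    rw [h]; exact I.sup_int
  nonneg := fun _ ht => ht.1

/-- The interval `{0}`. -/
def NatInterval.zero : NatInterval where
  carrier := {0}
  nonempty := ⟨0, rfl⟩
  ordConnected := Set.ordConnected_singleton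
  inf_int := Or.inr ⟨0, by simp⟩
  sup_int := Or.inr ⟨0, by simp⟩
  nonneg := by rintro _ rfl; exact le_rfl

@[simp] theorem NatInterval.zero_inf : NatInterval.zero.inf = 0 := by
  simp [IntInterval.inf, NatInterval.zero]

@[simp] theorem NatInterval.zero_sup : NatInterval.zero.sup = 0 := by
  simp [IntInterval.sup, NatInterval.zero]

/-- Each endpoint of `J` is `0` or the endpoint on the same side of an interval of `𝓘`. -/
def EndpointsIn (𝓘 : Set IntInterval) (J : NatInterval) : Prop :=
  (J.inf = 0 ∨ ∃ I ∈ 𝓘, I.inf = J.inf) ∧ (J.sup = 0 ∨ ∃ I ∈ 𝓘, I.sup = J.sup)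

theorem endpointsIn_zero (𝓘 : Set IntInterval) : EndpointsIn 𝓘 NatInterval.zero :=
  ⟨Or.inl NatInterval.zero_inf, Or.inl NatInterval.zero_sup⟩

theorem endpointsIn_common {𝓘 E : Set IntInterval} (hE : E.Finite) (hne : E.Nonempty)
    (hc : (commonPart E).Nonempty) (h : E ⊆ 𝓘) :
    EndpointsIn 𝓘 (NatInterval.common E hE hne hc) := by
  refine ⟨?_, ?_⟩
  · rcases exists_inf_commonPart hE hne hc with h0 | ⟨I, hI, h0⟩
    · exact Or.inl h0
    · exact Or.inr ⟨I, h hI, h0.symm⟩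
  · obtain ⟨I, hI, h0⟩ := exists_sup_commonPart hE hne hc
    exact Or.inr ⟨I, h hI, h0.symm⟩

theorem NatInterval.sup_nonneg (J : NatInterval) : 0 ≤ J.sup := by
  obtain ⟨t, ht⟩ := J.nonempty
  calc (0 : EReal) ≤ (t : EReal) := by exact_mod_cast J.nonneg t ht
    _ ≤ _ := le_sSup (Set.mem_image_of_mem _ ht)

/-- Positive non-adjacency passes to intervals of nonnegative reals with the same endpoints: a
common endpoint of two of them is nonnegative and, unless it is `0`, an endpoint of two intervals
of `𝓘`, hence at most `0`. -/
theorem EndpointsIn.sup_eq_zero {𝓘 : Set IntInterval}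
    (h𝓘 : ∀ I ∈ 𝓘, ∀ I' ∈ 𝓘, PosNonAdjacent I I') {J J' : NatInterval} (hJ : EndpointsIn 𝓘 J)
    (hJ' : EndpointsIn 𝓘 J') (h : J.sup = J'.inf) : J.sup = 0 := by
  rcases hJ.2 with h0 | ⟨I, hI, hs⟩
  · exact h0
  rcases hJ'.1 with h0 | ⟨I', hI', hi⟩
  · rw [h, h0]
  · refine le_antisymm ?_ J.sup_nonneg
    rw [← hs]
    exact (h𝓘 I hI I' hI').1 (by rw [hs, hi, h])

theorem EndpointsIn.nonAdjacent {𝓘 : Set IntInterval}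
    (h𝓘 : ∀ I ∈ 𝓘, ∀ I' ∈ 𝓘, PosNonAdjacent I I') {J J' : NatInterval} (hJ : EndpointsIn 𝓘 J)
    (hJ' : EndpointsIn 𝓘 J') : NonAdjacent J.toIntInterval J'.toIntInterval :=
  ⟨fun h => hJ.sup_eq_zero h𝓘 hJ' h, fun h => h.trans (hJ'.sup_eq_zero h𝓘 hJ h.symm)⟩

theorem IntInterval.inf_neg (I : IntInterval) : I.neg.inf = -I.sup := sInf_toEReal_neg _

theorem IntInterval.sup_neg (I : IntInterval) : I.neg.sup = -I.inf := sSup_toEReal_neg _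

@[simp] theorem IntInterval.mem_neg {I : IntInterval} {t : ℝ} :
    t ∈ I.neg.carrier ↔ -t ∈ I.carrier := Iff.rfl

theorem NegNonAdjacent.neg {I I' : IntInterval} (h : NegNonAdjacent I I') :
    PosNonAdjacent I.neg I'.neg := by
  simp only [PosNonAdjacent, IntInterval.inf_neg, IntInterval.sup_neg, neg_inj]
  exact ⟨fun h1 => by simpa [EReal.neg_le] using h.2 h1,
    fun h1 => by simpa [EReal.neg_le] using h.1 h1⟩

/-! ### Time reversal -/

/-- The timed word read backwards. -/
def TimedWord.rev {AP : Type u} (ρ : TimedWord AP) : TimedWord AP where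
  len := ρ.len
  len_pos := ρ.len_pos
  letter i := ρ.letter i.rev
  letter_nonempty i := ρ.letter_nonempty i.rev
  time i := ρ.time (Fin.rev ⟨0, ρ.len_pos⟩) - ρ.time i.rev
  time_zero := sub_self _
  time_mono := fun _ _ h => sub_le_sub_left (ρ.time_mono (Fin.rev_le_rev.2 h)) _

theorem segUp_congr {n : ℕ} {β : Type*} (b : Fin n → β) {P P' : Fin n → Prop} [DecidablePred P]
    [DecidablePred P'] (h : ∀ z, P z ↔ P' z) : segUp b P = segUp b P' := by
  simp only [segUp, h]

theorem segDown_eq_segUp_rev {n : ℕ} {β : Type*} (b : Fin n → β) (P P' : Fin n → Prop)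
    [DecidablePred P] [DecidablePred P'] (h : ∀ z, P' z ↔ P z.rev) :
    segDown b P = segUp (fun z => b z.rev) P' := by
  simp only [segDown, segUp, ← List.map_reverse, ← List.filter_reverse, List.finRange_reverse,
    List.filter_map, List.map_map, Function.comp_def, h]

namespace PnEMTL

variable {AP : Type u}

/-- The formula with future and past exchanged. -/
def mirror : PnEMTL AP → PnEMTL AP
  | atom a => atom a
  | and φ ψ => and φ.mirror ψ.mirror
  | not φ => not φ.mirror
  | fut k hk I m S q A => past k hk I m (fun s => (S s).mirror) q A
  | past k hk I m S q A => fut k hk I m (fun s => (S s).mirror) q A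

theorem size_mirror (α : PnEMTL AP) : α.mirror.size = α.size := by
  induction α <;> simp_all [mirror, size]

theorem AllModalities.mirror {F P : (k : ℕ) → (Fin k → NatInterval) → Prop} {α : PnEMTL AP}
    (h : α.AllModalities F P) : α.mirror.AllModalities P F := by
  induction α <;> simp_all [PnEMTL.mirror, AllModalities]

theorem AllModalities.mono {F P F' P' : (k : ℕ) → (Fin k → NatInterval) → Prop}
    (hF : ∀ k I, F k I → F' k I) (hP : ∀ k I, P k I → P' k I) {α : PnEMTL AP}
    (h : α.AllModalities F P) : α.AllModalities F' P' := by
  induction α <;> simp_all [AllModalities]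

/-- A modality holds in a word iff its mirror image, with the cut points reflected, holds in the
reversed word. -/
theorem exists_fut_iff_exists_past {n k m : ℕ} {I : Fin k → NatInterval} {q : Fin (k + 1) → ℕ}
    {A : (w : Fin (k + 1)) → NFA (Set (Fin m)) (Fin (q w))} {t t' : Fin n → ℝ}
    {b b' : Fin n → Set (Fin m)} (i i' : Fin n)
    (hi : i' = i.rev) (ht : ∀ z, t z - t i = t' i' - t' z.rev) (hb : ∀ z, b z = b' z.rev) :
    (∃ p : Fin (k + 1) → Fin n, p 0 = i ∧ Monotone p ∧
        (∀ w : Fin k, t (p w.succ) - t i ∈ (I w).carrier ∧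
          segUp b (fun z => p w.castSucc < z ∧ z ≤ p w.succ) ∈ (A w.castSucc).accepts) ∧
        segUp b (fun z => p (Fin.last k) < z) ∈ (A (Fin.last k)).accepts) ↔
    ∃ p : Fin (k + 1) → Fin n, p 0 = i' ∧ Antitone p ∧
        (∀ w : Fin k, t' i' - t' (p w.succ) ∈ (I w).carrier ∧
          segDown b' (fun z => p w.succ ≤ z ∧ z < p w.castSucc) ∈ (A w.castSucc).accepts) ∧
        segDown b' (fun z => z < p (Fin.last k)) ∈ (A (Fin.last k)).accepts := by
  obtain rfl : b = fun z => b' z.rev := funext hb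
  constructor
  · rintro ⟨p, h0, hp, h1, h2⟩
    refine ⟨fun w => (p w).rev, by simp [h0, hi], fun _ _ h => Fin.rev_le_rev.2 (hp h),
      fun w => ⟨ht _ ▸ (h1 w).1, ?_⟩, ?_⟩
    · rw [segDown_eq_segUp_rev _ _ (fun z => p w.castSucc < z ∧ z ≤ p w.succ)
        (fun z => by rw [Fin.rev_le_rev, Fin.rev_lt_rev, and_comm])]
      exact (h1 w).2
    · rw [segDown_eq_segUp_rev _ _ (fun z => p (Fin.last k) < z)
        (fun z => by rw [Fin.rev_lt_rev])]
      exact h2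
  · rintro ⟨p, h0, hp, h1, h2⟩
    refine ⟨fun w => (p w).rev, by simp [h0, hi], fun _ _ h => Fin.rev_le_rev.2 (hp h),
      fun w => ⟨by simpa [ht] using (h1 w).1, ?_⟩, ?_⟩
    · rw [← segDown_eq_segUp_rev b' (fun z => p w.succ ≤ z ∧ z < p w.castSucc) _
        (fun z => by rw [Fin.le_rev_iff, Fin.rev_lt_iff, and_comm])]
      exact (h1 w).2
    · rw [← segDown_eq_segUp_rev b' (fun z => z < p (Fin.last k)) _
        (fun z => by rw [Fin.rev_lt_iff])]
      exact h2

theorem sat_mirror (ρ : TimedWord AP) (α : PnEMTL AP) (i : Fin ρ.len) :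
    Sat ρ α.mirror i ↔ Sat ρ.rev α (i.rev : Fin ρ.len) := by
  induction α generalizing i with
  | atom a => simp [mirror, Sat, TimedWord.rev]
  | and φ ψ h1 h2 => simp only [mirror, Sat, h1, h2]
  | not φ h => simp only [mirror, Sat, h]
  | fut k hk I m S q A ih =>
    simp only [mirror, Sat, ih]
    exact (exists_fut_iff_exists_past (n := ρ.len) i.rev i i.rev_rev.symm
      (fun z => by simp [TimedWord.rev]) (fun z => by simp)).symm
  | past k hk I m S q A ih =>
    simp only [mirror, Sat, ih]
    exact exists_fut_iff_exists_past (n := ρ.len) i i.rev rfl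
      (fun z => by simp [TimedWord.rev]) (fun z => rfl)

/-! ### Boolean combinations -/

/-- An unsatisfiable formula: a modality whose automata have no states. -/
def bot : PnEMTL AP :=
  fut 1 one_pos (fun _ => NatInterval.zero) 0 Fin.elim0 (fun _ => 0)
    (fun _ => ⟨fun _ _ => ∅, ∅, ∅⟩)

theorem not_sat_bot (ρ : TimedWord AP) (i : Fin ρ.len) : ¬ Sat ρ bot i := by
  rintro ⟨p, -, -, -, h⟩
  obtain ⟨x, hx, -⟩ := NFA.mem_accepts.1 h
  exact hx

/-- Disjunction of a list of formulae. -/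
def disj : List (PnEMTL AP) → PnEMTL AP
  | [] => bot
  | α :: l => not (and (not α) (not (disj l)))

theorem sat_disj (ρ : TimedWord AP) (l : List (PnEMTL AP)) (i : Fin ρ.len) :
    Sat ρ (disj l) i ↔ ∃ α ∈ l, Sat ρ α i := by
  induction l with
  | nil => simpa [disj] using not_sat_bot ρ i
  | cons α l ih => simp only [disj, Sat, ih, List.exists_mem_cons_iff, not_and_or, not_not]

theorem size_disj {l : List (PnEMTL AP)} {B : ℕ} (h : ∀ α ∈ l, α.size ≤ B) :
    (disj l).size ≤ l.length * (B + 4) + 2 := by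
  induction l with
  | nil => simp [disj, bot, size, nfaSize]
  | cons α l ih =>
    have h1 := h α (by simp)
    have h2 := ih fun β hβ => h β (by simp [hβ])
    simp only [disj, size, List.length_cons]
    linarith

theorem allModalities_disj {F P : (k : ℕ) → (Fin k → NatInterval) → Prop}
    (hF : F 1 fun _ => NatInterval.zero) {l : List (PnEMTL AP)}
    (h : ∀ α ∈ l, α.AllModalities F P) : (disj l).AllModalities F P := by
  induction l with
  | nil => exact ⟨hF, fun s => s.elim0⟩
  | cons α l ih => exact ⟨h α (by simp), ih fun β hβ => h β (by simp [hβ])⟩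

theorem exists_disj {F P : (k : ℕ) → (Fin k → NatInterval) → Prop}
    (hF : F 1 fun _ => NatInterval.zero) {ι : Type*} [Finite ι] (f : ι → PnEMTL AP) {B : ℕ}
    (hB : ∀ x, (f x).size ≤ B) (h : ∀ x, (f x).AllModalities F P) :
    ∃ α : PnEMTL AP, (∀ ρ i, Sat ρ α i ↔ ∃ x, Sat ρ (f x) i) ∧
      α.size ≤ Nat.card ι * (B + 4) + 2 ∧ α.AllModalities F P := by
  have := Fintype.ofFinite ι
  refine ⟨disj ((Finset.univ : Finset ι).toList.map f), fun ρ i => by simp [sat_disj], ?_,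
    allModalities_disj hF (by simpa using h)⟩
  refine (size_disj (B := B) (by simpa using hB)).trans ?_
  simp

theorem exists_conj {F P : (k : ℕ) → (Fin k → NatInterval) → Prop}
    (hF : F 1 fun _ => NatInterval.zero) {ι : Type*} [Finite ι] (f : ι → PnEMTL AP) {B : ℕ}
    (hB : ∀ x, (f x).size ≤ B) (h : ∀ x, (f x).AllModalities F P) :
    ∃ α : PnEMTL AP, (∀ ρ i, Sat ρ α i ↔ ∀ x, Sat ρ (f x) i) ∧
      α.size ≤ Nat.card ι * (B + 5) + 3 ∧ α.AllModalities F P := by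
  obtain ⟨α, h1, h2, h3⟩ := exists_disj (P := P) hF (fun x => not (f x)) (B := B + 1)
    (fun x => Nat.succ_le_succ (hB x)) h
  exact ⟨not α, fun ρ i => by simp [Sat, h1], Nat.succ_le_succ h2, h3⟩

end PnEMTL

/-! ### Paths along a word and runs of automata -/

/-- `Path R a x c y`: the positions `a, …, c` can be labelled, from `x` at `a` to `y` at `c`, such
that `R z` relates the labels of `z - 1` and `z` for each position `z` in `(a, c]`. -/
inductive Path {n : ℕ} {σ : Type v} (R : Fin n → σ → σ → Prop) (a : Fin n) (x : σ) :
    Fin n → σ → Prop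
  | refl : Path R a x a x
  | step {c c' : Fin n} {y y' : σ} (h : Path R a x c y) (hc : (c' : ℕ) = c + 1)
      (hR : R c' y y') : Path R a x c' y'

namespace Path

variable {n : ℕ} {σ : Type v} {R R' : Fin n → σ → σ → Prop} {a c d : Fin n} {x y z : σ}

theorem le (h : Path R a x c y) : a ≤ c := by
  induction h with
  | refl => exact le_rfl
  | step _ hc _ ih => rw [Fin.le_def] at *; omega

theorem mono (h : Path R a x c y)
    (hR : ∀ z y y', a < z → z ≤ c → R z y y' → R' z y y') : Path R' a x c y := by
  induction h with
  | refl => exact refl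
  | step h hc h' ih =>
    have := h.le
    refine step (ih fun z y y' h1 h2 h3 => hR z y y' h1 ?_ h3) hc (hR _ _ _ ?_ le_rfl h')
    · rw [Fin.le_def] at *; omega
    · rw [Fin.le_def] at *; rw [Fin.lt_def]; omega

theorem trans (h : Path R a x c y) (h' : Path R c y d z) : Path R a x d z := by
  induction h' with
  | refl => exact h
  | step _ hc hR ih => exact ih.step hc hR

theorem self_iff : Path R a x a y ↔ y = x := by
  refine ⟨fun h => ?_, fun h => h ▸ refl⟩
  cases h with
  | refl => rfl
  | step h hc _ => have := h.le; rw [Fin.le_def] at this; omega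

theorem succ_iff (hac : a ≤ c) (hd : (d : ℕ) = c + 1) :
    Path R a x d z ↔ ∃ y, Path R a x c y ∧ R d y z := by
  refine ⟨fun h => ?_, fun ⟨y, h, hR⟩ => h.step hd hR⟩
  cases h with
  | refl => rw [Fin.le_def] at hac; omega
  | @step c₀ _ y _ h hc hR =>
    obtain rfl : c₀ = c := Fin.ext (by omega)
    exact ⟨y, h, hR⟩

theorem of_labelling (lab : Fin n → σ) (hac : a ≤ c)
    (h : ∀ z z' : Fin n, (z' : ℕ) = z + 1 → a ≤ z → z' ≤ c → R z' (lab z) (lab z')) :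
    Path R a (lab a) c (lab c) := by
  obtain ⟨k, hk⟩ := Nat.exists_eq_add_of_le (Fin.le_def.1 hac)
  induction k generalizing c with
  | zero =>
    obtain rfl : c = a := Fin.ext hk
    exact refl
  | succ k ih =>
    have hlt : (a : ℕ) + k < n := by omega
    refine step (c := ⟨a + k, hlt⟩)
      (ih (by simp [Fin.le_def]) (fun z z' h1 h2 h3 => h z z' h1 h2 ?_) rfl) (by simp [hk, add_assoc]) (h _ _ (by simp [hk, add_assoc]) (by simp [Fin.le_def]) le_rfl)
    rw [Fin.le_def] at *; simp only at h3; omega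

theorem exists_labelling (h : Path R a x c y) : ∃ lab : Fin n → σ, lab a = x ∧ lab c = y ∧
    ∀ z z' : Fin n, (z' : ℕ) = z + 1 → a ≤ z → z' ≤ c → R z' (lab z) (lab z') := by
  induction h with
  | refl =>
    refine ⟨fun _ => x, rfl, rfl, fun z z' h1 h2 h3 => ?_⟩
    rw [Fin.le_def] at *; omega
  | @step c c' y y' h hc hR ih =>
    obtain ⟨lab, ha, hy, hlab⟩ := ih
    have hac := Fin.le_def.1 h.le
    refine ⟨Function.update lab c' y', ?_, by simp, fun z z' h1 h2 h3 => ?_⟩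
    · rw [Function.update_of_ne (by rintro rfl; omega), ha]
    · rw [Fin.le_def] at *
      have hz : z ≠ c' := by rintro rfl; omega
      rw [Function.update_of_ne hz]
      by_cases hz' : z' = c'
      · subst hz'
        obtain rfl : z = c := Fin.ext (by omega)
        rw [Function.update_self, hy]
        exact hR
      · rw [Function.update_of_ne hz']
        refine hlab z z' h1 (Fin.le_def.2 h2) (Fin.le_def.2 ?_)
        have : (z' : ℕ) ≠ c' := fun h => hz' (Fin.ext h)
        omega

end Path

theorem segUp_eq_nil {n : ℕ} {β : Type*} {b : Fin n → β} {P : Fin n → Prop} [DecidablePred P] :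
    segUp b P = [] ↔ ∀ z, ¬ P z := by
  simp [segUp, List.filter_eq_nil_iff]

theorem segUp_succ {n : ℕ} {β : Type*} (b : Fin n → β) {a c d : Fin n} (hac : a ≤ c)
    (hd : (d : ℕ) = c + 1) :
    segUp b (fun z => a < z ∧ z ≤ d) = segUp b (fun z => a < z ∧ z ≤ c) ++ [b d] := by
  have : (List.finRange n).filter (fun z => a < z ∧ z ≤ d) =
      (List.finRange n).filter (fun z => a < z ∧ z ≤ c) ++ [d] := by
    apply List.SortedLT.eq_of_mem_iff
    · exact ((List.pairwise_lt_finRange n).filter _).sortedLT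
    · refine List.Pairwise.sortedLT (List.pairwise_append.2
        ⟨(List.pairwise_lt_finRange n).filter _, by simp, ?_⟩)
      simp only [List.mem_filter, List.mem_finRange, true_and, decide_eq_true_eq,
        List.mem_singleton, forall_eq, and_imp, Fin.lt_def, Fin.le_def]
      omega
    · simp only [List.mem_filter, List.mem_finRange, true_and, decide_eq_true_eq,
        List.mem_append, List.mem_singleton, Fin.ext_iff, Fin.lt_def, Fin.le_def] at *
      omega
  rw [segUp, this, List.map_append]
  rfl

theorem mem_evalFrom_segUp {n : ℕ} {β : Type*} {σ : Type v} (M : NFA β σ) (b : Fin n → β)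
    {a c : Fin n} (hac : a ≤ c) (x y : σ) :
    y ∈ M.evalFrom {x} (segUp b (fun z => a < z ∧ z ≤ c)) ↔
      Path (fun z q q' => q' ∈ M.step q (b z)) a x c y := by
  obtain ⟨k, hk⟩ := Nat.exists_eq_add_of_le (Fin.le_def.1 hac)
  induction k generalizing c y with
  | zero =>
    obtain rfl : c = a := Fin.ext hk
    rw [Path.self_iff, segUp_eq_nil.2 (fun z hz => hz.1.not_ge hz.2), NFA.evalFrom_nil]
    rfl
  | succ k ih =>
    have hlt : (a : ℕ) + k < n := by omega
    have h1 : a ≤ (⟨a + k, hlt⟩ : Fin n) := by simp [Fin.le_def]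
    have h2 : (c : ℕ) = (⟨a + k, hlt⟩ : Fin n) + 1 := by simp [hk, add_assoc]
    rw [Path.succ_iff h1 h2, segUp_succ b h1 h2, NFA.evalFrom_append, NFA.evalFrom_singleton,
      NFA.mem_stepSet]
    exact exists_congr fun y => and_congr_left' (ih h1 y rfl)

/-- The automaton `M` with its states renamed to `0, 1, …`. -/
noncomputable def nfaOnFin {β : Type*} {σ : Type v} [Finite σ] (M : NFA β σ) :
    NFA β (Fin (Nat.card σ)) where
  step x b := (Finite.equivFin σ).symm ⁻¹' M.step ((Finite.equivFin σ).symm x) b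
  start := (Finite.equivFin σ).symm ⁻¹' M.start
  accept := (Finite.equivFin σ).symm ⁻¹' M.accept

theorem accepts_nfaOnFin {β : Type*} {σ : Type v} [Finite σ] (M : NFA β σ) :
    (nfaOnFin M).accepts = M.accepts := by
  have key : ∀ (w : List β) (T : Set σ),
      (nfaOnFin M).evalFrom ((Finite.equivFin σ).symm ⁻¹' T) w =
        (Finite.equivFin σ).symm ⁻¹' M.evalFrom T w := by
    intro w
    induction w with
    | nil => simp
    | cons b w ih =>
      intro T
      rw [NFA.evalFrom_cons, NFA.evalFrom_cons, ← ih]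
      congr 1
      ext x
      simp only [NFA.mem_stepSet, Set.mem_preimage, nfaOnFin]
      exact (Finite.equivFin σ).symm.exists_congr fun _ => Iff.rfl
  ext w
  rw [NFA.mem_accepts, NFA.mem_accepts]
  change (∃ s, _ ∧ s ∈ (nfaOnFin M).evalFrom ((Finite.equivFin σ).symm ⁻¹' M.start) w) ↔ _
  rw [key]
  exact (Finite.equivFin σ).symm.exists_congr fun _ => Iff.rfl

theorem nfaSize_le {m n : ℕ} (M : NFA (Set (Fin m)) (Fin n)) : nfaSize M ≤ n + n * 2 ^ m * n := by
  refine Nat.add_le_add_left ((Set.ncard_le_card _).trans ?_) n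
  simp [mul_assoc, Nat.card_eq_fintype_card]

/-! ### Labelled runs and their segment automata -/

/-- A specification of runs along a word: labels with a transition relation, final labels, and the
set of time constraints that each label asserts at its position. -/
structure RunSpec (Q : Type u) (β : Type v) where
  step : Q → β → Q → Prop
  final : Set Q
  claims : Q → Set IntInterval

namespace RunSpec

variable {Q : Type u} {β : Type v} (M : RunSpec Q β)

/-- Accepts only the empty word. -/
def idleNFA : NFA β (Option Q) where
  step _ _ := ∅
  start := {none}
  accept := {none}

/-- Reads a segment between two cut points labelled `x` and `y`. The state is the label of the last
position read, and `none` once the second cut point has been read. The labels strictly in between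
claim only constraints that both cut points claim. -/
def betweenNFA (x y : Q) : NFA β (Option Q) where
  step o b := {o' | ∃ q, o = some q ∧ ((o' = none ∧ M.step q b y) ∨
    ∃ q', o' = some q' ∧ M.step q b q' ∧ M.claims q' ⊆ M.claims x ∩ M.claims y)}
  start := {some x}
  accept := {none}

/-- Reads the part of the word after a cut point labelled `x`, where nothing is claimed any more. -/
def tailNFA (x : Q) : NFA β (Option Q) where
  step o b := {o' | ∃ q q', o = some q ∧ o' = some q' ∧ M.step q b q' ∧ M.claims q' = ∅}
  start := {some x}
  accept := some '' M.final

theorem mem_accepts_idleNFA {w : List β} : w ∈ (idleNFA (Q := Q) (β := β)).accepts ↔ w = [] := by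
  rw [NFA.mem_accepts]
  rcases w.eq_nil_or_concat' with rfl | ⟨w, b, rfl⟩
  · simp [idleNFA]
  · simp [NFA.evalFrom_append, idleNFA, NFA.mem_stepSet]

variable {n : ℕ} {b : Fin n → β} {a c : Fin n} {x y : Q}

theorem mem_accepts_betweenNFA (hac : a ≤ c) :
    segUp b (fun z => a < z ∧ z ≤ c) ∈ (M.betweenNFA x y).accepts ↔
      Path (fun z o o' => o' ∈ (M.betweenNFA x y).step o (b z)) a (some x) c none := by
  rw [NFA.mem_accepts, ← mem_evalFrom_segUp _ _ hac]
  simp [betweenNFA]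

theorem exists_path_of_mem_betweenNFA (hac : a ≤ c)
    (h : segUp b (fun z => a < z ∧ z ≤ c) ∈ (M.betweenNFA x y).accepts) :
    ∃ (c' : Fin n) (q : Q), (c : ℕ) = c' + 1 ∧ Path (fun z q q' => M.step q (b z) q' ∧
      M.claims q' ⊆ M.claims x ∩ M.claims y) a x c' q ∧ M.step q (b c) y := by
  rw [mem_accepts_betweenNFA M hac] at h
  have key : ∀ c o, Path (fun z o o' => o' ∈ (M.betweenNFA x y).step o (b z)) a (some x) c o →
      ∀ q, o = some q → Path (fun z q q' => M.step q (b z) q' ∧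
        M.claims q' ⊆ M.claims x ∩ M.claims y) a x c q := by
    intro c o h
    induction h with
    | refl => rintro q ⟨⟩; exact Path.refl
    | step h hc hR ih =>
      rintro q rfl
      obtain ⟨q₀, rfl, ⟨h', -⟩ | ⟨q', h', hs⟩⟩ := hR
      · cases h'
      · cases h'
        exact (ih q₀ rfl).step hc hs
  cases h with
  | @step c' _ o _ h hc hR =>
    obtain ⟨q, rfl, ⟨-, hs⟩ | ⟨q', h', -⟩⟩ := hR
    · exact ⟨c', q, hc, key _ _ h q rfl, hs⟩
    · cases h'

theorem mem_accepts_betweenNFA_of_labelling (lab : Fin n → Q) (hac : a < c)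
    (hs : ∀ z z' : Fin n, (z' : ℕ) = z + 1 → a ≤ z → M.step (lab z) (b z') (lab z'))
    (hcl : ∀ z, a < z → z < c → M.claims (lab z) ⊆ M.claims (lab a) ∩ M.claims (lab c)) :
    segUp b (fun z => a < z ∧ z ≤ c) ∈ (M.betweenNFA (lab a) (lab c)).accepts := by
  rw [mem_accepts_betweenNFA M hac.le]
  have := Path.of_labelling (a := a) (c := c)
    (R := fun z o o' => o' ∈ (M.betweenNFA (lab a) (lab c)).step o (b z))
    (fun z => if z = c then none else some (lab z)) hac.le ?_
  · simpa [hac.ne] using this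
  · intro z z' h1 h2 h3
    have hz : z ≠ c := by rintro rfl; rw [Fin.le_def] at h3; omega
    refine ⟨lab z, by simp [hz], ?_⟩
    by_cases hz' : z' = c
    · exact Or.inl ⟨by simp [hz'], hz' ▸ hs z z' h1 h2⟩
    · refine Or.inr ⟨lab z', by simp [hz'], hs z z' h1 h2, hcl z' ?_ (lt_of_le_of_ne h3 hz')⟩
      rw [Fin.le_def] at h2; rw [Fin.lt_def]; omega

theorem mem_accepts_tailNFA (hc : (c : ℕ) + 1 = n) :
    segUp b (fun z => a < z) ∈ (M.tailNFA x).accepts ↔ ∃ q ∈ M.final,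
      Path (fun z o o' => o' ∈ (M.tailNFA x).step o (b z)) a (some x) c (some q) := by
  have hle : ∀ z : Fin n, z ≤ c := fun z => by rw [Fin.le_def]; omega
  rw [segUp_congr b (P' := fun z => a < z ∧ z ≤ c) (fun z => by simp [hle z]), NFA.mem_accepts]
  simp only [← mem_evalFrom_segUp _ _ (hle a)]
  simp [tailNFA]

theorem exists_path_of_mem_tailNFA (hc : (c : ℕ) + 1 = n)
    (h : segUp b (fun z => a < z) ∈ (M.tailNFA x).accepts) :
    ∃ q ∈ M.final,
      Path (fun z q q' => M.step q (b z) q' ∧ M.claims q' = ∅) a x c q := by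
  obtain ⟨q, hq, h⟩ := (M.mem_accepts_tailNFA hc).1 h
  refine ⟨q, hq, ?_⟩
  have key : ∀ c o, Path (fun z o o' => o' ∈ (M.tailNFA x).step o (b z)) a (some x) c o →
      ∀ q, o = some q → Path (fun z q q' => M.step q (b z) q' ∧ M.claims q' = ∅) a x c q := by
    intro c o h
    induction h with
    | refl => rintro q ⟨⟩; exact Path.refl
    | step h hc hR ih =>
      rintro q rfl
      obtain ⟨q₀, q', rfl, h', hs⟩ := hR
      cases h'
      exact (ih q₀ rfl).step hc hs
  exact key _ _ h q rfl

theorem mem_accepts_tailNFA_of_labelling (lab : Fin n → Q) (hc : (c : ℕ) + 1 = n)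
    (hs : ∀ z z' : Fin n, (z' : ℕ) = z + 1 → a ≤ z → M.step (lab z) (b z') (lab z'))
    (hcl : ∀ z, a < z → M.claims (lab z) = ∅) (hf : lab c ∈ M.final) :
    segUp b (fun z => a < z) ∈ (M.tailNFA (lab a)).accepts := by
  rw [M.mem_accepts_tailNFA hc]
  refine ⟨_, hf, Path.of_labelling (fun z => some (lab z)) (by rw [Fin.le_def]; omega) ?_⟩
  intro z z' h1 h2 h3
  refine ⟨lab z, lab z', rfl, rfl, hs z z' h1 h2, hcl z' ?_⟩
  rw [Fin.le_def] at h2; rw [Fin.lt_def]; omega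

end RunSpec

/-! ### Timed runs to the right of a position -/

/-- The set of those indices `j` for which the proposition `a j` holds at the position `z`. -/
def TimedWord.letterOn {AP : Type u} {m : ℕ} (ρ : TimedWord AP) (a : Fin m → AP) (z : Fin ρ.len) :
    Set (Fin m) := {j | a j ∈ ρ.letter z}

namespace RunSpec

variable {AP : Type u} {Q : Type v} {m : ℕ}

/-- `lab` labels the positions from `i` on by a run of `M`, ending in a final label. -/
def IsRun {n : ℕ} (M : RunSpec Q (Set (Fin m))) (b : Fin n → Set (Fin m)) (i : Fin n)
    (lab : Fin n → Q) : Prop :=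
  (∀ z z' : Fin n, (z' : ℕ) = z + 1 → i ≤ z → M.step (lab z) (b z') (lab z')) ∧
    ∀ c : Fin n, (c : ℕ) + 1 = n → lab c ∈ M.final

variable (M : RunSpec Q (Set (Fin m)))

/-- Every label of the list `s` claims some constraint, and its claims are jointly satisfiable
at or after the reference position. -/
def CutValid {k : ℕ} (s : Fin k → Q) : Prop :=
  ∀ v, (M.claims (s v)).Nonempty ∧ (commonPart (M.claims (s v))).Nonempty

/-- The labels `x, s 0, …, s (k - 1)` of the cut points. -/
def cutLabel {k : ℕ} (x : Q) (s : Fin k → Q) : Fin (k + 1) → Q := Fin.cons x s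

/-- The automata of the segments: the first one is empty, so that the first cut point is the
reference position itself. -/
def cutNFA {k : ℕ} (x : Q) (s : Fin k → Q) : Fin (k + 2) → NFA (Set (Fin m)) (Option Q) :=
  Fin.cons idleNFA (Fin.snoc (α := fun _ => NFA (Set (Fin m)) (Option Q))
    (fun v => M.betweenNFA (cutLabel x s v.castSucc) (cutLabel x s v.succ))
    (M.tailNFA (cutLabel x s (Fin.last k))))

/-- The intervals of the cut points. -/
def cutInterval {k : ℕ} (hfin : ∀ q, (M.claims q).Finite) (s : Fin k → Q) (hs : M.CutValid s) :
    Fin (k + 1) → NatInterval :=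
  Fin.cons NatInterval.zero
    fun v => NatInterval.common (M.claims (s v)) (hfin _) (hs v).1 (hs v).2

/-- There is a run from `x` at the current position whose cut points are labelled `s`. -/
noncomputable def cutFormula [Finite Q] {k : ℕ} (a : Fin m → AP)
    (hfin : ∀ q, (M.claims q).Finite) (x : Q) (s : Fin k → Q) (hs : M.CutValid s) : PnEMTL AP :=
  PnEMTL.fut (k + 1) k.succ_pos (M.cutInterval hfin s hs) m (fun j => PnEMTL.atom (a j))
    (fun _ => Nat.card (Option Q)) fun w => nfaOnFin (M.cutNFA x s w)

theorem sat_cutFormula [Finite Q] {k : ℕ} (a : Fin m → AP) (hfin : ∀ q, (M.claims q).Finite)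
    (x : Q) (s : Fin k → Q) (hs : M.CutValid s) (ρ : TimedWord AP) (i : Fin ρ.len) :
    PnEMTL.Sat ρ (M.cutFormula a hfin x s hs) i ↔
      ∃ p : Fin (k + 1) → Fin ρ.len, p 0 = i ∧ Monotone p ∧
        (∀ v : Fin k, ρ.time (p v.succ) - ρ.time i ∈ commonPart (M.claims (s v)) ∧
          segUp (ρ.letterOn a) (fun z => p v.castSucc < z ∧ z ≤ p v.succ) ∈
            (M.betweenNFA (cutLabel x s v.castSucc) (cutLabel x s v.succ)).accepts) ∧
        segUp (ρ.letterOn a) (fun z => p (Fin.last k) < z) ∈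
          (M.tailNFA (cutLabel x s (Fin.last k))).accepts := by
  simp only [cutFormula, PnEMTL.Sat, accepts_nfaOnFin, Fin.forall_fin_succ (n := k)]
  constructor
  · rintro ⟨p, h0, hp, ⟨⟨-, h1⟩, h2⟩, h3⟩
    have h4 : p (Fin.succ 0) = i := by
      refine le_antisymm (not_lt.1 fun hlt => ?_) (h0 ▸ hp (Fin.zero_le _))
      exact segUp_eq_nil.1 (mem_accepts_idleNFA.1 h1) _ ⟨by simpa [h0] using hlt, le_rfl⟩
    refine ⟨fun v => p v.succ, h4, fun _ _ h => hp (Fin.succ_le_succ_iff.2 h),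
      fun v => ⟨(h2 v).1, ?_⟩, ?_⟩
    · have := (h2 v).2
      rw [← Fin.succ_castSucc] at this
      simp only [cutNFA, Fin.cons_succ, Fin.snoc_castSucc] at this
      exact this
    · rw [← Fin.succ_last] at h3
      simp only [cutNFA, Fin.cons_succ, Fin.snoc_last] at h3
      exact h3
  · rintro ⟨p, h0, hp, h1, h2⟩
    refine ⟨Fin.cons i p, rfl, ?_, ⟨⟨?_, ?_⟩, fun v => ⟨(h1 v).1, ?_⟩⟩, ?_⟩
    · refine Fin.monotone_iff_le_succ.2 fun v => ?_
      cases v using Fin.cases with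
      | zero => simp [h0]
      | succ v => exact hp (Fin.castSucc_lt_succ (i := v)).le
    · simp [h0, cutInterval, NatInterval.zero]
    · refine mem_accepts_idleNFA.2 (segUp_eq_nil.2 fun z hz => ?_)
      have : i < z ∧ z ≤ p 0 := hz
      exact this.1.not_ge (h0 ▸ this.2)
    · rw [← Fin.succ_castSucc]
      simp only [cutNFA, Fin.cons_succ, Fin.snoc_castSucc]
      exact (h1 v).2
    · rw [← Fin.succ_last]
      simp only [cutNFA, Fin.cons_succ, Fin.snoc_last]
      exact h2

/-- Between two cut points a label claims only what both cut points claim, so the claims hold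
there by convexity of intervals; after the last cut point nothing is claimed. -/
theorem exists_run_of_sat_cutFormula [Finite Q] {k : ℕ} (a : Fin m → AP)
    (hfin : ∀ q, (M.claims q).Finite) {x : Q} (hx : ∀ I ∈ M.claims x, (0 : ℝ) ∈ I.carrier)
    (s : Fin k → Q) (hs : M.CutValid s) (ρ : TimedWord AP) (i : Fin ρ.len)
    (h : PnEMTL.Sat ρ (M.cutFormula a hfin x s hs) i) :
    ∃ lab : Fin ρ.len → Q, lab i = x ∧ M.IsRun (ρ.letterOn a) i lab ∧
      ∀ z, i < z → ∀ I ∈ M.claims (lab z), ρ.time z - ρ.time i ∈ I.carrier := by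
  obtain ⟨p, h0, hp, h1, h2⟩ := (M.sat_cutFormula a hfin x s hs ρ i).1 h
  have hcut : ∀ v, ∀ I ∈ M.claims (cutLabel x s v), ρ.time (p v) - ρ.time i ∈ I.carrier := by
    intro v I hI
    cases v using Fin.cases with
    | zero => rw [h0, sub_self]; exact hx I hI
    | succ v => exact (h1 v).1.2 I hI
  have hpath : ∀ v, Path (fun z q q' => M.step q (ρ.letterOn a z) q' ∧
      ∀ I ∈ M.claims q', ρ.time z - ρ.time i ∈ I.carrier) i x (p v) (cutLabel x s v) := by
    intro v
    induction v using Fin.induction with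
    | zero => rw [h0]; exact Path.refl
    | succ v ih =>
      obtain ⟨c, q, hc, hpq, hq⟩ := M.exists_path_of_mem_betweenNFA
        (hp (Fin.castSucc_lt_succ (i := v)).le) (h1 v).2
      refine ih.trans (Path.step (hpq.mono fun z y y' hz hzc hy => ⟨hy.1, fun I hI => ?_⟩) hc
        ⟨hq, hcut _⟩)
      have hz' : z ≤ p v.succ := by rw [Fin.le_def] at *; omega
      exact I.ordConnected.out (hcut _ I (hy.2 hI).1) (hcut _ I (hy.2 hI).2)
        ⟨sub_le_sub_right (ρ.time_mono hz.le) _, sub_le_sub_right (ρ.time_mono hz') _⟩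
  obtain ⟨c, hc⟩ : ∃ c : Fin ρ.len, (c : ℕ) + 1 = ρ.len :=
    ⟨⟨ρ.len - 1, Nat.sub_lt ρ.len_pos one_pos⟩, Nat.sub_add_cancel ρ.len_pos⟩
  obtain ⟨q, hq, htail⟩ := M.exists_path_of_mem_tailNFA hc h2
  obtain ⟨lab, hi, hl, hlab⟩ := ((hpath _).trans (htail.mono fun z y y' _ _ hy =>
    ⟨hy.1, by simp [hy.2]⟩)).exists_labelling
  have hle : ∀ z : Fin ρ.len, z ≤ c := fun z => by rw [Fin.le_def]; omega
  refine ⟨lab, hi, ⟨fun z z' h h' => (hlab z z' h h' (hle z')).1, fun c' hc' => ?_⟩,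
    fun z hz => ?_⟩
  · obtain rfl : c' = c := Fin.ext (by omega)
    rwa [hl]
  · rw [Fin.lt_def] at hz
    exact (hlab ⟨z - 1, by omega⟩ z (by simp only; omega)
      (by rw [Fin.le_def]; simp only; omega) (hle z)).2

/-- The positions after `i` which are the first or the last one at which some constraint is
claimed. -/
def cutSet {n : ℕ} (i : Fin n) (lab : Fin n → Q) : Set (Fin n) :=
  {z | i < z ∧ ∃ I ∈ M.claims (lab z), (∀ y, i < y → y < z → I ∉ M.claims (lab y)) ∨
    ∀ y, z < y → I ∉ M.claims (lab y)}

theorem ncard_cutSet_le {𝓘 : Set IntInterval} (h𝓘 : 𝓘.Finite) (hcl : ∀ q, M.claims q ⊆ 𝓘) {n : ℕ}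
    (i : Fin n) (lab : Fin n → Q) : (M.cutSet i lab).ncard ≤ 2 * 𝓘.ncard := by
  have h : ∀ z ∈ M.cutSet i lab, ∃ e : IntInterval × Bool, e.1 ∈ M.claims (lab z) ∧
      (e.2 = true → ∀ y, i < y → y < z → e.1 ∉ M.claims (lab y)) ∧
      (e.2 = false → ∀ y, z < y → e.1 ∉ M.claims (lab y)) := by
    rintro z ⟨-, I, hI, h | h⟩
    · exact ⟨(I, true), hI, fun _ => h, by simp⟩
    · exact ⟨(I, false), hI, by simp, fun _ => h⟩
  have : Nonempty IntInterval := ⟨NatInterval.zero.toIntInterval⟩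
  choose! f hf1 hf2 hf3 using h
  have hne : ∀ z ∈ M.cutSet i lab, ∀ z' ∈ M.cutSet i lab, z < z' → f z ≠ f z' := by
    intro z hz z' hz' hlt heq
    cases hb : (f z).2 with
    | true => exact hf2 z' hz' (heq ▸ hb) z hz.1 hlt (heq ▸ hf1 z hz)
    | false => exact hf3 z hz hb z' hlt (heq ▸ hf1 z' hz')
  have hinj : Set.InjOn f (M.cutSet i lab) := fun z hz z' hz' heq => by
    by_contra hne'
    rcases lt_or_gt_of_ne hne' with hlt | hlt
    · exact hne z hz z' hz' hlt heq
    · exact hne z' hz' z hz hlt heq.symm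
  calc (M.cutSet i lab).ncard ≤ (𝓘 ×ˢ (Set.univ : Set Bool)).ncard :=
        Set.ncard_le_ncard_of_injOn f (fun z hz => ⟨hcl _ (hf1 z hz), trivial⟩) hinj
          (h𝓘.prod Set.finite_univ)
    _ = 2 * 𝓘.ncard := by
        rw [Set.ncard_prod, Set.ncard_univ, Nat.card_eq_fintype_card, Fintype.card_bool, mul_comm]

/-- If the labels claim precisely the constraints of `𝓘` that hold, then the cut set serves as the
set of cut points: a constraint that holds strictly between two consecutive ones holds at both. -/
theorem exists_sat_cutFormula [Finite Q] {𝓘 : Set IntInterval} (h𝓘 : 𝓘.Finite)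
    (hcl : ∀ q, M.claims q ⊆ 𝓘) (a : Fin m → AP) (hfin : ∀ q, (M.claims q).Finite)
    (ρ : TimedWord AP) (i : Fin ρ.len) (lab : Fin ρ.len → Q) (hrun : M.IsRun (ρ.letterOn a) i lab)
    (hex : ∀ z, i ≤ z → M.claims (lab z) = {I ∈ 𝓘 | ρ.time z - ρ.time i ∈ I.carrier}) :
    ∃ k ≤ 2 * 𝓘.ncard, ∃ (s : Fin k → Q) (hs : M.CutValid s),
      PnEMTL.Sat ρ (M.cutFormula a hfin (lab i) s hs) i := by
  classical
  obtain ⟨C, hC⟩ := (M.cutSet i lab).toFinite.exists_finset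
  have hcard : C.card ≤ 2 * 𝓘.ncard := by
    rw [← Set.ncard_coe_finset, show (C : Set (Fin ρ.len)) = M.cutSet i lab from Set.ext hC]
    exact M.ncard_cutSet_le h𝓘 hcl i lab
  set e := C.orderEmbOfFin rfl with he
  have heC : ∀ v, e v ∈ M.cutSet i lab := fun v => (hC _).1 (C.orderEmbOfFin_mem rfl v)
  have hrange : ∀ z ∈ M.cutSet i lab, ∃ v, e v = z := fun z hz => by
    have : z ∈ Set.range e := by rw [he, Finset.range_orderEmbOfFin]; exact (hC z).2 hz
    exact this
  set p : Fin (C.card + 1) → Fin ρ.len := Fin.cons i e with hp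
  have hlabel : ∀ v, cutLabel (lab i) (lab ∘ e) v = lab (p v) := by
    intro v
    cases v using Fin.cases <;> rfl
  have hpmono : StrictMono p := by
    intro v w hvw
    cases w using Fin.cases with
    | zero => exact absurd hvw (Fin.not_lt_zero _)
    | succ w =>
      cases v using Fin.cases with
      | zero => exact (heC w).1
      | succ v => exact e.strictMono (Fin.succ_lt_succ_iff.1 hvw)
  have hpi : ∀ v, i ≤ p v := fun v => hpmono.monotone (Fin.zero_le v)
  have hmem : ∀ z, i ≤ z → ∀ I ∈ M.claims (lab z), ρ.time z - ρ.time i ∈ I.carrier :=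
    fun z hz I hI => by rw [hex z hz] at hI; exact hI.2
  -- A claimed constraint has a first and a last position, both of which are cut points.
  have hfirst : ∀ z, i < z → ∀ I ∈ M.claims (lab z), ∃ y ∈ M.cutSet i lab, y ≤ z ∧
      I ∈ M.claims (lab y) := by
    intro z hz I hI
    obtain ⟨y, hy, hmin⟩ := Set.exists_min_image {y | i < y ∧ y ≤ z ∧ I ∈ M.claims (lab y)} id
      (Set.toFinite _) ⟨z, hz, le_rfl, hI⟩
    exact ⟨y, ⟨hy.1, I, hy.2.2, Or.inl fun y' h1 h2 h3 =>
      h2.not_ge (hmin y' ⟨h1, h2.le.trans hy.2.1, h3⟩)⟩, hy.2.1, hy.2.2⟩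
  have hlast : ∀ z, i < z → ∀ I ∈ M.claims (lab z), ∃ y ∈ M.cutSet i lab, z ≤ y ∧
      I ∈ M.claims (lab y) := by
    intro z hz I hI
    obtain ⟨y, hy, hmax⟩ := Set.exists_max_image {y | z ≤ y ∧ I ∈ M.claims (lab y)} id
      (Set.toFinite _) ⟨z, le_rfl, hI⟩
    exact ⟨y, ⟨hz.trans_le hy.1, I, hy.2, Or.inr fun y' h2 h3 =>
      h2.not_ge (hmax y' ⟨hy.1.trans h2.le, h3⟩)⟩, hy.1, hy.2⟩
  have hs : M.CutValid (lab ∘ e) := by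
    intro v
    obtain ⟨hv, I, hI, -⟩ := heC v
    exact ⟨⟨I, hI⟩, _, sub_nonneg.2 (ρ.time_mono hv.le), hmem _ hv.le⟩
  refine ⟨C.card, hcard, lab ∘ e, hs, ?_⟩
  rw [sat_cutFormula]
  refine ⟨p, rfl, hpmono.monotone, fun v => ⟨?_, ?_⟩, ?_⟩
  · exact ⟨sub_nonneg.2 (ρ.time_mono (heC v).1.le), hmem _ (heC v).1.le⟩
  · rw [hlabel, hlabel]
    refine M.mem_accepts_betweenNFA_of_labelling lab (hpmono Fin.castSucc_lt_succ)
      (fun z z' h1 h2 => hrun.1 z z' h1 ((hpi _).trans h2)) fun z hz1 hz2 I hI => ?_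
    have hiz : i < z := (hpi _).trans_lt hz1
    -- No cut point lies strictly between two consecutive ones.
    have hgap : ∀ y ∈ M.cutSet i lab, y ≤ p v.castSucc ∨ p v.succ ≤ y := by
      intro y hy
      obtain ⟨w, rfl⟩ := hrange y hy
      change p w.succ ≤ _ ∨ _ ≤ p w.succ
      rw [hpmono.le_iff_le, hpmono.le_iff_le, Fin.le_def, Fin.le_def]
      simp only [Fin.val_succ, Fin.val_castSucc]
      omega
    obtain ⟨y, hy, hyz, hyI⟩ := hfirst z hiz I hI
    obtain ⟨y', hy', hzy', hyI'⟩ := hlast z hiz I hI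
    have hy1 : y ≤ p v.castSucc := (hgap y hy).resolve_right fun h => (h.trans hyz).not_gt hz2
    have hy2 : p v.succ ≤ y' := (hgap y' hy').resolve_left fun h => (hzy'.trans h).not_gt hz1
    have hconv : ∀ w, y ≤ w → w ≤ y' → I ∈ M.claims (lab w) := by
      intro w h1 h2
      rw [hex w (hy.1.le.trans h1)]
      exact ⟨hcl _ hI, I.ordConnected.out (hmem y hy.1.le I hyI) (hmem y' hy'.1.le I hyI')
        ⟨sub_le_sub_right (ρ.time_mono h1) _, sub_le_sub_right (ρ.time_mono h2) _⟩⟩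
    exact ⟨hconv _ hy1 (hz1.le.trans hzy'), hconv _ (hyz.trans hz2.le) hy2⟩
  · rw [hlabel]
    obtain ⟨c, hc⟩ : ∃ c : Fin ρ.len, (c : ℕ) + 1 = ρ.len :=
      ⟨⟨ρ.len - 1, Nat.sub_lt ρ.len_pos one_pos⟩, Nat.sub_add_cancel ρ.len_pos⟩
    refine M.mem_accepts_tailNFA_of_labelling lab hc
      (fun z z' h1 h2 => hrun.1 z z' h1 ((hpi _).trans h2)) (fun z hz => ?_) (hrun.2 c hc)
    refine Set.eq_empty_of_forall_notMem fun I hI => ?_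
    obtain ⟨y, hy, hzy, -⟩ := hlast z ((hpi _).trans_lt hz) I hI
    obtain ⟨w, rfl⟩ := hrange y hy
    exact (hz.trans_le hzy).not_ge (hpmono.monotone (Fin.le_last w.succ))

theorem size_cutFormula_le [Finite Q] {k : ℕ} (a : Fin m → AP) (hfin : ∀ q, (M.claims q).Finite)
    (x : Q) (s : Fin k → Q) (hs : M.CutValid s) :
    (M.cutFormula a hfin x s hs).size ≤ k + 2 + m +
      (k + 2) * (Nat.card Q + 1 + (Nat.card Q + 1) * 2 ^ m * (Nat.card Q + 1)) := by
  have h1 : ∑ w, nfaSize (nfaOnFin (M.cutNFA x s w)) ≤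
      (k + 2) * (Nat.card Q + 1 + (Nat.card Q + 1) * 2 ^ m * (Nat.card Q + 1)) := by
    refine (Finset.sum_le_card_nsmul _ _ _ fun w _ => nfaSize_le _).trans ?_
    simp [Finite.card_option]
  have h2 : ∑ j, (PnEMTL.atom (a j)).size = m := by simp [PnEMTL.size]
  have h3 : (M.cutFormula a hfin x s hs).size = 1 + (k + 1) + ∑ j, (PnEMTL.atom (a j)).size +
      ∑ w, nfaSize (nfaOnFin (M.cutNFA x s w)) := rfl
  rw [h3, h2]
  omega

/-- A formula which holds at `i` if the labelling with the true constraints is a run from `x`, and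
only if there is a run from `x` on whose labels claim true constraints. -/
theorem exists_runFormula [Finite Q] {𝓘 : Set IntInterval} (h𝓘 : 𝓘.Finite)
    (hcl : ∀ q, M.claims q ⊆ 𝓘) (a : Fin m → AP) {x : Q}
    (hx : ∀ I ∈ M.claims x, (0 : ℝ) ∈ I.carrier) : ∃ α : PnEMTL AP,
      (∀ ρ i, PnEMTL.Sat ρ α i → ∃ lab : Fin ρ.len → Q, lab i = x ∧
        M.IsRun (ρ.letterOn a) i lab ∧
        ∀ z, i < z → ∀ I ∈ M.claims (lab z), ρ.time z - ρ.time i ∈ I.carrier) ∧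
      (∀ ρ i (lab : Fin ρ.len → Q), lab i = x → M.IsRun (ρ.letterOn a) i lab →
        (∀ z, i ≤ z → M.claims (lab z) = {I ∈ 𝓘 | ρ.time z - ρ.time i ∈ I.carrier}) →
        PnEMTL.Sat ρ α i) ∧
      α.size ≤ (2 * 𝓘.ncard + 1) * Nat.card Q ^ (2 * 𝓘.ncard) * (2 * 𝓘.ncard + 2 + m +
        (2 * 𝓘.ncard + 2) *
          (Nat.card Q + 1 + (Nat.card Q + 1) * 2 ^ m * (Nat.card Q + 1)) + 4) + 2 ∧
      α.AllModalities (fun k I => k ≤ 2 * 𝓘.ncard + 1 ∧ ∀ w, EndpointsIn 𝓘 (I w))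
        (fun _ _ => False) := by
  have hfin : ∀ q, (M.claims q).Finite := fun q => h𝓘.subset (hcl q)
  have : Nonempty Q := ⟨x⟩
  have hsize : ∀ d : Σ k : Fin (2 * 𝓘.ncard + 1), {s : Fin k → Q // M.CutValid s},
      (M.cutFormula a hfin x d.2.1 d.2.2).size ≤ 2 * 𝓘.ncard + 2 + m + (2 * 𝓘.ncard + 2) *
          (Nat.card Q + 1 + (Nat.card Q + 1) * 2 ^ m * (Nat.card Q + 1)) := by
    rintro ⟨k, s, hs⟩
    refine (M.size_cutFormula_le a hfin x s hs).trans ?_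
    have := Nat.lt_succ_iff.1 k.2
    gcongr
  have hmod : ∀ d : Σ k : Fin (2 * 𝓘.ncard + 1), {s : Fin k → Q // M.CutValid s},
      (M.cutFormula a hfin x d.2.1 d.2.2).AllModalities
        (fun k I => k ≤ 2 * 𝓘.ncard + 1 ∧ ∀ w, EndpointsIn 𝓘 (I w)) (fun _ _ => False) := by
    rintro ⟨k, s, hs⟩
    refine ⟨⟨k.2, fun w => ?_⟩, fun _ => trivial⟩
    cases w using Fin.cases with
    | zero => exact endpointsIn_zero 𝓘
    | succ w => exact endpointsIn_common (hfin _) (hs w).1 (hs w).2 (hcl _)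
  obtain ⟨α, h1, h2, h3⟩ := PnEMTL.exists_disj
    ⟨Nat.succ_le_succ (Nat.zero_le _), fun _ => endpointsIn_zero 𝓘⟩ _ hsize hmod
  refine ⟨α, fun ρ i h => ?_, fun ρ i lab hi hrun hex => ?_, h2.trans ?_, h3⟩
  · obtain ⟨d, hd⟩ := (h1 ρ i).1 h
    exact M.exists_run_of_sat_cutFormula a hfin hx _ _ ρ i hd
  · obtain ⟨k, hk, s, hs, h⟩ := M.exists_sat_cutFormula h𝓘 hcl a hfin ρ i lab hrun hex
    subst hi
    exact (h1 ρ i).2 ⟨⟨⟨k, Nat.lt_succ_of_le hk⟩, s, hs⟩, h⟩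
  · gcongr
    rw [Nat.card_sigma]
    refine (Finset.sum_le_card_nsmul _ _ (Nat.card Q ^ (2 * 𝓘.ncard)) fun k _ => ?_).trans
      (by simp)
    refine (Finite.card_subtype_le _).trans ?_
    rw [Nat.card_fun, Nat.card_eq_fintype_card (α := Fin _), Fintype.card_fin]
    exact Nat.pow_le_pow_right Nat.card_pos (Nat.lt_succ_iff.1 k.2)

end RunSpec

/-! ### Timed runs to the left of a position -/

namespace RunSpec

variable {AP : Type u} {Q : Type v} {m : ℕ}

theorem isRun_rev_iff (M : RunSpec Q (Set (Fin m))) {n : ℕ} (b : Fin n → Set (Fin m)) (i : Fin n)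
    (lab : Fin n → Q) :
    M.IsRun (fun z => b z.rev) i.rev (fun z => lab z.rev) ↔
      (∀ z z' : Fin n, (z' : ℕ) = z + 1 → z' ≤ i → M.step (lab z') (b z) (lab z)) ∧
        ∀ c : Fin n, (c : ℕ) = 0 → lab c ∈ M.final := by
  constructor
  · refine fun h => ⟨fun z z' h1 h2 => ?_, fun c hc => ?_⟩
    · have := h.1 z'.rev z.rev (by simp only [Fin.val_rev]; omega) (Fin.rev_le_rev.2 h2)
      simpa using this
    · have := h.2 c.rev (by simp only [Fin.val_rev]; omega)
      simpa using this
  · refine fun h => ⟨fun z z' h1 h2 => ?_, fun c hc => ?_⟩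
    · exact h.1 z'.rev z.rev (by simp only [Fin.val_rev]; omega) (Fin.rev_le_iff.1 h2)
    · exact h.2 c.rev (by simp only [Fin.val_rev]; omega)

/-- The counterpart of `exists_runFormula` for runs that read the word backwards, obtained by
reversing time. -/
theorem exists_pastRunFormula [Finite Q] (M : RunSpec Q (Set (Fin m))) {𝓘 : Set IntInterval}
    (h𝓘 : 𝓘.Finite) (hcl : ∀ q, M.claims q ⊆ 𝓘) (a : Fin m → AP) {x : Q}
    (hx : ∀ I ∈ M.claims x, (0 : ℝ) ∈ I.carrier) : ∃ α : PnEMTL AP,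
      (∀ ρ i, PnEMTL.Sat ρ α i → ∃ lab : Fin ρ.len → Q, lab i = x ∧
        (∀ z z' : Fin ρ.len, (z' : ℕ) = z + 1 → z' ≤ i →
          M.step (lab z') (ρ.letterOn a z) (lab z)) ∧
        (∀ c : Fin ρ.len, (c : ℕ) = 0 → lab c ∈ M.final) ∧
        ∀ z, z < i → ∀ I ∈ M.claims (lab z), ρ.time i - ρ.time z ∈ I.carrier) ∧
      (∀ ρ i (lab : Fin ρ.len → Q), lab i = x →
        (∀ z z' : Fin ρ.len, (z' : ℕ) = z + 1 → z' ≤ i →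
          M.step (lab z') (ρ.letterOn a z) (lab z)) →
        (∀ c : Fin ρ.len, (c : ℕ) = 0 → lab c ∈ M.final) →
        (∀ z, z ≤ i → M.claims (lab z) = {I ∈ 𝓘 | ρ.time i - ρ.time z ∈ I.carrier}) →
        PnEMTL.Sat ρ α i) ∧
      α.size ≤ (2 * 𝓘.ncard + 1) * Nat.card Q ^ (2 * 𝓘.ncard) * (2 * 𝓘.ncard + 2 + m +
        (2 * 𝓘.ncard + 2) *
          (Nat.card Q + 1 + (Nat.card Q + 1) * 2 ^ m * (Nat.card Q + 1)) + 4) + 2 ∧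
      α.AllModalities (fun _ _ => False)
        (fun k I => k ≤ 2 * 𝓘.ncard + 1 ∧ ∀ w, EndpointsIn 𝓘 (I w)) := by
  obtain ⟨α, h1, h2, h3, h4⟩ := M.exists_runFormula h𝓘 hcl a hx
  refine ⟨α.mirror, fun ρ i h => ?_, fun ρ i lab hi hs hf hex => ?_,
    α.size_mirror.trans_le h3, h4.mirror⟩
  · obtain ⟨lab, hi, hrun, hlab⟩ : ∃ lab : Fin ρ.len → Q, lab i.rev = x ∧
        M.IsRun (fun z => ρ.letterOn a z.rev) i.rev lab ∧ ∀ z : Fin ρ.len, i.rev < z →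
          ∀ I ∈ M.claims (lab z), ρ.rev.time z - ρ.rev.time i.rev ∈ I.carrier :=
      h1 ρ.rev _ ((PnEMTL.sat_mirror ρ α i).1 h)
    have hrun' := (M.isRun_rev_iff (ρ.letterOn a) i fun z => lab z.rev).1 (by simpa using hrun)
    refine ⟨fun z => lab z.rev, hi, hrun'.1, hrun'.2, fun z hz I hI => ?_⟩
    simpa [TimedWord.rev] using hlab z.rev (Fin.rev_lt_rev.2 hz) I hI
  · refine (PnEMTL.sat_mirror ρ α i).2 (h2 ρ.rev _ (fun z : Fin ρ.len => lab z.rev) ?_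
      ((M.isRun_rev_iff (ρ.letterOn a) i lab).2 ⟨hs, hf⟩) fun z hz => ?_)
    · simp [hi]
    · refine (hex (Fin.rev (n := ρ.len) z) (Fin.rev_le_iff.1 hz)).trans ?_
      simp [TimedWord.rev]

end RunSpec

/-! ### Subformulae -/

namespace TPTL

variable {AP : Type u}

/-- The set of subformulae. -/
def sub : TPTL AP → Set (TPTL AP)
  | atom a => {atom a}
  | natom a => {natom a}
  | top => {top}
  | bot => {bot}
  | diff I => {diff I}
  | rdiff I => {rdiff I}
  | freeze φ => insert (freeze φ) (sub φ)
  | box φ => insert (box φ) (sub φ)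
  | pbox φ => insert (pbox φ) (sub φ)
  | and φ ψ => insert (and φ ψ) (sub φ ∪ sub ψ)
  | or φ ψ => insert (or φ ψ) (sub φ ∪ sub ψ)
  | untl φ ψ => insert (untl φ ψ) (sub φ ∪ sub ψ)
  | snce φ ψ => insert (snce φ ψ) (sub φ ∪ sub ψ)

theorem self_mem_sub (φ : TPTL AP) : φ ∈ sub φ := by
  cases φ <;> simp [sub]

theorem sub_finite (φ : TPTL AP) : (sub φ).Finite := by
  induction φ <;> simp_all [sub]

theorem ncard_insert_union_le {α : Type*} (x : α) {s t : Set α} {k l : ℕ} (hs : s.ncard ≤ k)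
    (ht : t.ncard ≤ l) : (insert x (s ∪ t)).ncard ≤ k + l + 1 :=
  (Set.ncard_insert_le _ _).trans
    (Nat.succ_le_succ ((Set.ncard_union_le _ _).trans (Nat.add_le_add hs ht)))

theorem ncard_insert_le_succ {α : Type*} (x : α) {s : Set α} {k : ℕ} (hs : s.ncard ≤ k) :
    (insert x s).ncard ≤ k + 1 :=
  (Set.ncard_insert_le _ _).trans (Nat.succ_le_succ hs)

theorem ncard_sub_le (φ : TPTL AP) : (sub φ).ncard ≤ φ.size := by
  induction φ with
  | atom | natom | top | bot | diff | rdiff => simp [sub, size]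
  | freeze φ h | box φ h | pbox φ h => exact ncard_insert_le_succ _ h
  | and φ ψ h h' | or φ ψ h h' | untl φ ψ h h' | snce φ ψ h h' => exact ncard_insert_union_le _ h h'

theorem sub_subset {φ ψ : TPTL AP} (h : ψ ∈ sub φ) : sub ψ ⊆ sub φ := by
  induction φ with
  | atom | natom | top | bot | diff | rdiff => obtain rfl := h; exact subset_rfl
  | freeze φ ih | box φ ih | pbox φ ih =>
    rcases h with rfl | h
    · exact subset_rfl
    · exact (ih h).trans (Set.subset_insert _ _)
  | and φ ψ ih ih' | or φ ψ ih ih' | untl φ ψ ih ih' | snce φ ψ ih ih' =>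
    rcases h with rfl | h | h
    · exact subset_rfl
    · exact (ih h).trans (Set.subset_union_left.trans (Set.subset_insert _ _))
    · exact (ih' h).trans (Set.subset_union_right.trans (Set.subset_insert _ _))

theorem FreezeFree.of_mem_sub {φ ψ : TPTL AP} (hφ : φ.FreezeFree) (h : ψ ∈ sub φ) :
    ψ.FreezeFree := by
  induction φ with
  | atom | natom | top | bot | diff | rdiff => obtain rfl := h; exact hφ
  | freeze φ ih => exact hφ.elim
  | box φ ih | pbox φ ih =>
    rcases h with rfl | h
    · exact hφ
    · exact ih hφ h
  | and φ ψ ih ih' | or φ ψ ih ih' | untl φ ψ ih ih' | snce φ ψ ih ih' =>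
    rcases h with rfl | h | h
    · exact hφ
    · exact ih hφ.1 h
    · exact ih' hφ.2 h

theorem FreezeFree.scopeIntervals_eq {φ : TPTL AP} (hφ : φ.FreezeFree) :
    φ.scopeIntervals = φ.intervals := by
  induction φ <;> simp_all [FreezeFree, scopeIntervals, intervals]

/-- The intervals `I` such that the constraint `T - x ∈ I` belongs to `T`, possibly in the form
`x - T ∈ -I`. -/
def claimed (T : Set (TPTL AP)) : Set IntInterval :=
  {I | diff I ∈ T ∨ ∃ J, rdiff J ∈ T ∧ J.neg = I}

theorem claimed_sub (φ : TPTL AP) : claimed (sub φ) = φ.intervals := by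
  induction φ with
  | atom | natom | top | bot => simp [claimed, sub, intervals]
  | diff I => ext; simp [claimed, sub, intervals]
  | rdiff I => ext; simp [claimed, sub, intervals, eq_comm]
  | freeze φ ih | box φ ih | pbox φ ih =>
    rw [intervals, ← ih]
    simp [claimed, sub]
  | and φ ψ ih ih' | or φ ψ ih ih' | untl φ ψ ih ih' | snce φ ψ ih ih' =>
    rw [intervals, ← ih, ← ih']
    ext I
    simp only [claimed, sub, Set.mem_insert_iff, Set.mem_union, Set.mem_ofPred_eq, reduceCtorEq,
      false_or, or_and_right, exists_or]
    exact or_or_or_comm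

theorem claimed_mono {T T' : Set (TPTL AP)} (h : T ⊆ T') : claimed T ⊆ claimed T' := by
  rintro I (hI | ⟨J, hJ, rfl⟩)
  · exact Or.inl (h hI)
  · exact Or.inr ⟨J, h hJ, rfl⟩

theorem ncard_intervals_le (φ : TPTL AP) : φ.intervals.ncard ≤ φ.size := by
  induction φ with
  | atom | natom | top | bot | diff | rdiff => simp [intervals, size]
  | freeze φ h | box φ h | pbox φ h => exact h.trans (Nat.le_succ _)
  | and φ ψ h h' | or φ ψ h h' | untl φ ψ h h' | snce φ ψ h h' =>
    exact (Set.ncard_union_le _ _).trans ((Nat.add_le_add h h').trans (Nat.le_succ _))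

/-- The propositions occurring in a formula. -/
def props : TPTL AP → List AP
  | atom a | natom a => [a]
  | top | bot | diff _ | rdiff _ => []
  | freeze φ | box φ | pbox φ => props φ
  | and φ ψ | or φ ψ | untl φ ψ | snce φ ψ => props φ ++ props ψ

theorem length_props_le (φ : TPTL AP) : φ.props.length ≤ φ.size := by
  induction φ <;> simp [props, size] <;> omega

theorem mem_props {φ : TPTL AP} {a : AP} (h : atom a ∈ sub φ ∨ natom a ∈ sub φ) :
    a ∈ φ.props := by
  induction φ <;> simp_all [sub, props]
  all_goals tauto

/-! ### Hintikka labellings -/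

/-- The conditions on the set `T` of formulae asserted at one position, where `b` is the set of the
indices of the propositions that hold there. -/
structure LocallyOk {m : ℕ} (a : Fin m → AP) (T : Set (TPTL AP)) (b : Set (Fin m)) : Prop where
  atom : ∀ j, atom (a j) ∈ T → j ∈ b
  natom : ∀ j, natom (a j) ∈ T → j ∉ b
  bot : bot ∉ T
  and : ∀ φ ψ, and φ ψ ∈ T → φ ∈ T ∧ ψ ∈ T
  or : ∀ φ ψ, or φ ψ ∈ T → φ ∈ T ∨ ψ ∈ T

/-- The conditions on the sets `T` and `T'` of formulae asserted at two successive positions. -/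
structure Linked (T T' : Set (TPTL AP)) : Prop where
  untl : ∀ φ ψ, untl φ ψ ∈ T → ψ ∈ T' ∨ (φ ∈ T' ∧ untl φ ψ ∈ T')
  snce : ∀ φ ψ, snce φ ψ ∈ T' → ψ ∈ T ∨ (φ ∈ T ∧ snce φ ψ ∈ T)
  box : ∀ φ, box φ ∈ T → φ ∈ T' ∧ box φ ∈ T'
  pbox : ∀ φ, pbox φ ∈ T' → φ ∈ T ∧ pbox φ ∈ T

/-- The formulae asserted at the last position contain no until. -/
def LastOk (T : Set (TPTL AP)) : Prop := ∀ φ ψ, untl φ ψ ∉ T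

/-- The formulae asserted at the first position contain no since. -/
def FirstOk (T : Set (TPTL AP)) : Prop := ∀ φ ψ, snce φ ψ ∉ T

/-- Whatever a Hintikka labelling asserts is true. No converse is needed, as formulae are in
negation normal form. -/
theorem sat_of_hintikka {m : ℕ} {a : Fin m → AP} {θ : TPTL AP} (hθ : θ.FreezeFree)
    (ha : ∀ p ∈ θ.props, ∃ j, a j = p) (ρ : TimedWord AP) (ν : ℝ)
    (lab : Fin ρ.len → Set (TPTL AP)) (hsub : ∀ z, lab z ⊆ sub θ)
    (hloc : ∀ z, LocallyOk a (lab z) (ρ.letterOn a z))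
    (hlink : ∀ z z' : Fin ρ.len, (z' : ℕ) = z + 1 → Linked (lab z) (lab z'))
    (hfirst : ∀ z : Fin ρ.len, (z : ℕ) = 0 → FirstOk (lab z))
    (hlast : ∀ z : Fin ρ.len, (z : ℕ) + 1 = ρ.len → LastOk (lab z))
    (hcl : ∀ z, ∀ I ∈ claimed (lab z), ρ.time z - ν ∈ I.carrier)
    {χ : TPTL AP} {z : Fin ρ.len} (hz : χ ∈ lab z) : Sat ρ χ z ν := by
  induction χ generalizing z with
  | atom p =>
    obtain ⟨j, rfl⟩ := ha p (mem_props (Or.inl (hsub z hz)))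
    exact (hloc z).atom j hz
  | natom p =>
    obtain ⟨j, rfl⟩ := ha p (mem_props (Or.inr (hsub z hz)))
    exact (hloc z).natom j hz
  | top => trivial
  | bot => exact ((hloc z).bot hz).elim
  | freeze φ => exact (hθ.of_mem_sub (hsub z hz)).elim
  | diff I => exact hcl z I (Or.inl hz)
  | rdiff I => simpa [Sat] using hcl z I.neg (Or.inr ⟨I, hz, rfl⟩)
  | and φ ψ h h' =>
    obtain ⟨h1, h2⟩ := (hloc z).and _ _ hz
    exact ⟨h h1, h' h2⟩
  | or φ ψ h h' => exact ((hloc z).or _ _ hz).imp h h'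
  | untl φ ψ h h' =>
    obtain ⟨d, hd⟩ := Nat.exists_eq_add_of_lt z.2
    induction d generalizing z with
    | zero => exact (hlast z hd.symm _ _ hz).elim
    | succ d ih =>
      obtain ⟨z', hz'⟩ : ∃ z' : Fin ρ.len, (z' : ℕ) = z + 1 := ⟨⟨z + 1, by omega⟩, rfl⟩
      have hlt : z < z' := by rw [Fin.lt_def]; omega
      rcases (hlink z z' hz').untl _ _ hz with h1 | ⟨h1, h2⟩
      · refine ⟨z', hlt, h' h1, fun k hk hk' => ?_⟩
        rw [Fin.lt_def] at hk hk'; omega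
      · obtain ⟨y, hy, hy1, hy2⟩ := ih h2 (by omega)
        refine ⟨y, hlt.trans hy, hy1, fun k hk hk' => ?_⟩
        by_cases hkz : k = z'
        · exact hkz ▸ h h1
        · refine hy2 k ?_ hk'
          have : (k : ℕ) ≠ z' := fun h => hkz (Fin.ext h)
          rw [Fin.lt_def] at *; omega
  | snce φ ψ h h' =>
    obtain ⟨d, hd⟩ : ∃ d, (z : ℕ) = d := ⟨_, rfl⟩
    induction d generalizing z with
    | zero => exact (hfirst z hd _ _ hz).elim
    | succ d ih =>
      obtain ⟨z', hz'⟩ : ∃ z' : Fin ρ.len, (z : ℕ) = z' + 1 := ⟨⟨d, by omega⟩, hd⟩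
      have hlt : z' < z := by rw [Fin.lt_def]; omega
      rcases (hlink z' z hz').snce _ _ hz with h1 | ⟨h1, h2⟩
      · refine ⟨z', hlt, h' h1, fun k hk hk' => ?_⟩
        rw [Fin.lt_def] at hk hk'; omega
      · obtain ⟨y, hy, hy1, hy2⟩ := ih h2 (by omega)
        refine ⟨y, hy.trans hlt, hy1, fun k hk hk' => ?_⟩
        by_cases hkz : k = z'
        · exact hkz ▸ h h1
        · refine hy2 k hk ?_
          have : (k : ℕ) ≠ z' := fun h => hkz (Fin.ext h)
          rw [Fin.lt_def] at *; omega
  | box φ h =>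
    have key : ∀ d : ℕ, ∀ y : Fin ρ.len, (y : ℕ) = z + d + 1 → φ ∈ lab y ∧ box φ ∈ lab y := by
      intro d
      induction d with
      | zero => exact fun y hy => (hlink z y hy).box _ hz
      | succ d ih =>
        exact fun y hy => (hlink ⟨z + d + 1, by omega⟩ y hy).box _ (ih _ rfl).2
    intro y hy
    obtain ⟨d, hd⟩ := Nat.exists_eq_add_of_lt (Fin.lt_def.1 hy)
    exact h (key d y hd).1
  | pbox φ h =>
    have key : ∀ d : ℕ, ∀ y : Fin ρ.len, (z : ℕ) = y + d + 1 → φ ∈ lab y ∧ pbox φ ∈ lab y := by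
      intro d
      induction d with
      | zero => exact fun y hy => (hlink y z hy).pbox _ hz
      | succ d ih =>
        exact fun y hy => (hlink y ⟨y + 1, by omega⟩ rfl).pbox _ (ih _ (by simp only; omega)).2
    intro y hy
    obtain ⟨d, hd⟩ := Nat.exists_eq_add_of_lt (Fin.lt_def.1 hy)
    exact h (key d y hd).1

/-- The subformulae of `θ` which hold at the position `z`. -/
def trueSub (θ : TPTL AP) (ρ : TimedWord AP) (ν : ℝ) (z : Fin ρ.len) : Set (TPTL AP) :=
  {χ ∈ sub θ | Sat ρ χ z ν}

section

variable {m : ℕ} (θ : TPTL AP) (ρ : TimedWord AP) (ν : ℝ)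

theorem locallyOk_trueSub (a : Fin m → AP) (z : Fin ρ.len) :
    LocallyOk a (trueSub θ ρ ν z) (ρ.letterOn a z) where
  atom _ h := h.2
  natom _ h := h.2
  bot h := h.2
  and φ ψ h := ⟨⟨sub_subset h.1 (by simp [sub, self_mem_sub]), h.2.1⟩,
    ⟨sub_subset h.1 (by simp [sub, self_mem_sub]), h.2.2⟩⟩
  or φ ψ h := h.2.imp (fun h' => ⟨sub_subset h.1 (by simp [sub, self_mem_sub]), h'⟩)
    (fun h' => ⟨sub_subset h.1 (by simp [sub, self_mem_sub]), h'⟩)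

theorem linked_trueSub (z z' : Fin ρ.len) (hz : (z' : ℕ) = z + 1) :
    Linked (trueSub θ ρ ν z) (trueSub θ ρ ν z') where
  untl φ ψ := by
    rintro ⟨hC, y, hy, h1, h2⟩
    by_cases hyz : y = z'
    · exact Or.inl ⟨sub_subset hC (by simp [sub, self_mem_sub]), hyz ▸ h1⟩
    · have : (y : ℕ) ≠ z' := fun h => hyz (Fin.ext h)
      simp only [Fin.lt_def] at *
      refine Or.inr ⟨⟨sub_subset hC (by simp [sub, self_mem_sub]), h2 z' (by omega) (by omega)⟩,
        hC, y, by rw [Fin.lt_def]; omega, h1, fun k hk hk' => ?_⟩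
      simp only [Fin.lt_def] at *
      exact h2 k (by omega) hk'
  snce φ ψ := by
    rintro ⟨hC, y, hy, h1, h2⟩
    by_cases hyz : y = z
    · exact Or.inl ⟨sub_subset hC (by simp [sub, self_mem_sub]), hyz ▸ h1⟩
    · have : (y : ℕ) ≠ z := fun h => hyz (Fin.ext h)
      simp only [Fin.lt_def] at *
      refine Or.inr ⟨⟨sub_subset hC (by simp [sub, self_mem_sub]), h2 z (by omega) (by omega)⟩,
        hC, y, by rw [Fin.lt_def]; omega, h1, fun k hk hk' => ?_⟩
      simp only [Fin.lt_def] at *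
      exact h2 k hk (by omega)
  box φ h := by
    have hlt : z < z' := by rw [Fin.lt_def]; omega
    exact ⟨⟨sub_subset h.1 (by simp [sub, self_mem_sub]), h.2 z' hlt⟩, h.1,
      fun y hy => h.2 y (hlt.trans hy)⟩
  pbox φ h := by
    have hlt : z < z' := by rw [Fin.lt_def]; omega
    exact ⟨⟨sub_subset h.1 (by simp [sub, self_mem_sub]), h.2 z hlt⟩, h.1,
      fun y hy => h.2 y (hy.trans hlt)⟩

theorem lastOk_trueSub (z : Fin ρ.len) (hz : (z : ℕ) + 1 = ρ.len) :
    LastOk (trueSub θ ρ ν z) := by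
  rintro φ ψ ⟨-, y, hy, -⟩
  rw [Fin.lt_def] at hy; omega

theorem firstOk_trueSub (z : Fin ρ.len) (hz : (z : ℕ) = 0) : FirstOk (trueSub θ ρ ν z) := by
  rintro φ ψ ⟨-, y, hy, -⟩
  rw [Fin.lt_def] at hy; omega

theorem claimed_trueSub (z : Fin ρ.len) :
    claimed (trueSub θ ρ ν z) = {I ∈ θ.intervals | ρ.time z - ν ∈ I.carrier} := by
  rw [← claimed_sub]
  ext I
  constructor
  · rintro (⟨h1, h2⟩ | ⟨J, ⟨h1, h2⟩, rfl⟩)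
    · exact ⟨Or.inl h1, h2⟩
    · exact ⟨Or.inr ⟨J, h1, rfl⟩, by simpa [Sat] using h2⟩
  · rintro ⟨h1 | ⟨J, h1, rfl⟩, h2⟩
    · exact Or.inl ⟨h1, h2⟩
    · exact Or.inr ⟨J, ⟨h1, by simpa [Sat] using h2⟩, rfl⟩

end

/-- Runs towards the end of the word whose labels are sets of subformulae of `θ`. -/
def futureSpec {m : ℕ} (θ : TPTL AP) (a : Fin m → AP) : RunSpec (𝒫 (sub θ)) (Set (Fin m)) where
  step T b T' := LocallyOk a T'.1 b ∧ Linked T.1 T'.1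
  final := {T | LastOk T.1}
  claims T := claimed T.1

/-- Runs towards the beginning of the word whose labels are sets of subformulae of `θ`. -/
def pastSpec {m : ℕ} (θ : TPTL AP) (a : Fin m → AP) : RunSpec (𝒫 (sub θ)) (Set (Fin m)) where
  step T b T' := LocallyOk a T'.1 b ∧ Linked T'.1 T.1
  final := {T | FirstOk T.1}
  claims T := IntInterval.neg '' claimed T.1

end TPTL

/-! ### Assembling the formula -/

theorem runSize_le {n m q N : ℕ} (hn : n ≤ N) (hm : m ≤ N) (hq : q ≤ 2 ^ N) :
    (2 * n + 1) * q ^ (2 * n) * (2 * n + 2 + m +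
      (2 * n + 2) * (q + 1 + (q + 1) * 2 ^ m * (q + 1)) + 4) + 2 ≤
      2 ^ (2 * N ^ 2 + 5 * N + 8) := by
  have hN : N + 1 ≤ 2 ^ N := Nat.lt_two_pow_self
  have h1 : 2 * n + 2 ≤ 2 ^ (N + 1) := by rw [pow_succ]; omega
  have h2 : q ^ (2 * n) ≤ 2 ^ (2 * N ^ 2) := by
    calc q ^ (2 * n) ≤ (2 ^ N) ^ (2 * n) := Nat.pow_le_pow_left hq _
      _ ≤ (2 ^ N) ^ (2 * N) := Nat.pow_le_pow_right (by positivity) (by omega)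
      _ = 2 ^ (2 * N ^ 2) := by rw [← pow_mul]; ring_nf
  have h3 : q + 1 ≤ 2 ^ (N + 1) := by rw [pow_succ]; omega
  have h4 : q + 1 + (q + 1) * 2 ^ m * (q + 1) ≤ 2 ^ (3 * N + 3) := by
    calc q + 1 + (q + 1) * 2 ^ m * (q + 1)
        ≤ 2 ^ (3 * N + 2) + 2 ^ (N + 1) * 2 ^ N * 2 ^ (N + 1) :=
          Nat.add_le_add (h3.trans (Nat.pow_le_pow_right two_pos (by omega)))
            (Nat.mul_le_mul (Nat.mul_le_mul h3 (Nat.pow_le_pow_right two_pos hm)) h3)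
      _ = 2 ^ (3 * N + 3) := by ring
  have h5 : 2 * n + 2 + m + (2 * n + 2) * (q + 1 + (q + 1) * 2 ^ m * (q + 1)) + 4 ≤
      2 ^ (4 * N + 6) := by
    have h6 : (2 * n + 2) * (q + 1 + (q + 1) * 2 ^ m * (q + 1)) ≤ 2 ^ (4 * N + 4) :=
      (Nat.mul_le_mul h1 h4).trans_eq (by ring)
    have h7 : 2 ^ N ≤ 2 ^ (4 * N) := Nat.pow_le_pow_right two_pos (by omega)
    rw [pow_add] at h6 ⊢
    omega
  calc _ ≤ 2 ^ (N + 1) * 2 ^ (2 * N ^ 2) * 2 ^ (4 * N + 6) + 2 :=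
        Nat.add_le_add_right (Nat.mul_le_mul (Nat.mul_le_mul (by omega) h2) h5) 2
    _ = 2 ^ (2 * N ^ 2 + 5 * N + 7) + 2 := by ring
    _ ≤ 2 ^ (2 * N ^ 2 + 5 * N + 7) + 2 ^ (2 * N ^ 2 + 5 * N + 7) :=
        Nat.add_le_add_left (Nat.le_self_pow (by omega) 2) _
    _ = 2 ^ (2 * N ^ 2 + 5 * N + 8) := by ring

namespace PnEMTL

variable {AP : Type u}

theorem exists_letterFormula {F P : (k : ℕ) → (Fin k → NatInterval) → Prop}
    (hF : F 1 fun _ => NatInterval.zero) {m : ℕ} (a : Fin m → AP) (b : Set (Fin m)) :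
    ∃ α : PnEMTL AP, (∀ (ρ : TimedWord AP) i, Sat ρ α i ↔ ρ.letterOn a i = b) ∧
      α.size ≤ m * 7 + 3 ∧ α.AllModalities F P := by
  classical
  obtain ⟨α, h1, h2, h3⟩ := exists_conj (AP := AP) (P := P) hF
    (fun j => if j ∈ b then atom (a j) else not (atom (a j))) (B := 2)
    (fun j => by split_ifs <;> simp [size]) (fun j => by split_ifs <;> trivial)
  refine ⟨α, fun ρ i => (h1 ρ i).trans ?_, by simpa using h2, h3⟩
  rw [Set.ext_iff]
  refine forall_congr' fun j => ?_
  by_cases hj : j ∈ b <;> simp [hj, Sat, TimedWord.letterOn]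

end PnEMTL

namespace TPTL

variable {AP : Type u}

/-- The modalities of the formula under construction: few intervals, with endpoints from `𝓘`. -/
def ModalityOk (𝓘 : Set IntInterval) (k : ℕ) (I : Fin k → NatInterval) : Prop :=
  k ≤ 2 * 𝓘.ncard + 1 ∧ ∀ w, EndpointsIn 𝓘 (I w)

theorem modalityOk_zero (𝓘 : Set IntInterval) : ModalityOk 𝓘 1 fun _ => NatInterval.zero :=
  ⟨Nat.succ_le_succ (Nat.zero_le _), fun _ => endpointsIn_zero 𝓘⟩

/-- One disjunct of the translation, for a set `x` of subformulae of `θ` with `θ ∈ x` and a letter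
`b`. It implies that `θ` holds when the variable is frozen at the current time, and it is implied by
the letter being `b` and `x` being the set of all subformulae that then hold. -/
theorem exists_typeFormula {θ : TPTL AP} (hθ : θ.FreezeFree) {m : ℕ} (a : Fin m → AP)
    (ha : ∀ p ∈ θ.props, ∃ j, a j = p) {N : ℕ} (hN : θ.size ≤ N) (hm : m ≤ N)
    (x : 𝒫 (sub θ)) (b : Set (Fin m)) (hx : θ ∈ x.1) (hloc : LocallyOk a x.1 b)
    (hcl : ∀ I ∈ claimed x.1, (0 : ℝ) ∈ I.carrier) :
    ∃ α : PnEMTL AP, (∀ ρ i, PnEMTL.Sat ρ α i → Sat ρ θ i (ρ.time i)) ∧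
      (∀ ρ i, trueSub θ ρ (ρ.time i) i = x.1 → ρ.letterOn a i = b → PnEMTL.Sat ρ α i) ∧
      α.size ≤ m * 7 + 3 + 2 * 2 ^ (2 * N ^ 2 + 5 * N + 8) + 2 ∧
      α.AllModalities (ModalityOk θ.intervals) (ModalityOk (IntInterval.neg '' θ.intervals)) := by
  have : Finite (𝒫 (sub θ)) := θ.sub_finite.finite_subsets.to_subtype
  have hcard : Nat.card (𝒫 (sub θ)) ≤ 2 ^ N := by
    rw [Nat.card_coe_set_eq, Set.ncard_powerset _ θ.sub_finite]
    exact Nat.pow_le_pow_right two_pos (θ.ncard_sub_le.trans hN)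
  have hn : θ.intervals.ncard ≤ N := θ.ncard_intervals_le.trans hN
  have hn' : (IntInterval.neg '' θ.intervals).ncard ≤ N :=
    (Set.ncard_image_le θ.intervals_finite).trans hn
  have hclaims : ∀ q : 𝒫 (sub θ), claimed q.1 ⊆ θ.intervals := fun q => by
    rw [← claimed_sub]
    exact claimed_mono q.2
  obtain ⟨β, hβ, hβs, hβm⟩ := PnEMTL.exists_letterFormula (P := ModalityOk
    (IntInterval.neg '' θ.intervals)) (modalityOk_zero θ.intervals) a b
  obtain ⟨F, hF, hF', hFs, hFm⟩ := (futureSpec θ a).exists_runFormula (x := x) θ.intervals_finite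
    hclaims a hcl
  obtain ⟨P, hP, hP', hPs, hPm⟩ := (pastSpec θ a).exists_pastRunFormula (x := x)
    (θ.intervals_finite.image IntInterval.neg) (fun q => Set.image_mono (hclaims q)) a
    (by rintro _ ⟨I, hI, rfl⟩; simpa using hcl I hI)
  refine ⟨.and β (.and F P), fun ρ i h => ?_, fun ρ i hxi hbi => ?_, ?_, hβm,
    hFm.mono (fun _ _ h => h) (fun _ _ h => h.elim),
    hPm.mono (fun _ _ h => h.elim) (fun _ _ h => h)⟩
  · obtain ⟨h1, h2, h3⟩ := h
    obtain ⟨lab, hi, hrun, hlab⟩ := hF ρ i h2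
    obtain ⟨lab', hi', hstep, hfirst, hlab'⟩ := hP ρ i h3
    -- The labellings of the two sides agree at `i`.
    have hl : ∀ z, i ≤ z → (if i ≤ z then lab z else lab' z) = lab z := fun z hz => if_pos hz
    have hr : ∀ z, z ≤ i → (if i ≤ z then lab z else lab' z) = lab' z := fun z hz => by
      split_ifs with h
      · rw [le_antisymm hz h, hi, hi']
      · rfl
    have hpred : ∀ z z' : Fin ρ.len, z < z' → ∃ y : Fin ρ.len, (z' : ℕ) = y + 1 ∧ z ≤ y :=
      fun z z' h => by
        rw [Fin.lt_def] at h
        exact ⟨⟨z' - 1, by omega⟩, by simp only; omega, by rw [Fin.le_def]; simp only; omega⟩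
    have hsucc : ∀ z z' : Fin ρ.len, z < z' → ∃ y : Fin ρ.len, (y : ℕ) = z + 1 ∧ y ≤ z' :=
      fun z z' h => by
        rw [Fin.lt_def] at h
        exact ⟨⟨z + 1, by omega⟩, rfl, by rw [Fin.le_def]; simp only; omega⟩
    refine sat_of_hintikka hθ ha ρ (ρ.time i) (fun z => (if i ≤ z then lab z else lab' z).1)
      (fun z => (if i ≤ z then lab z else lab' z).2) (fun z => ?_) (fun z z' hz => ?_)
      (fun z hz => ?_) (fun z hz => ?_) (fun z I hI => ?_) ?_
    · rcases lt_trichotomy z i with h | rfl | h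
      · obtain ⟨y, hy, hyi⟩ := hsucc z i h
        simp only [hr z h.le]
        exact (hstep z y hy hyi).1
      · simp only [le_refl, ↓reduceIte, hi]
        exact (hβ ρ z).1 h1 ▸ hloc
      · obtain ⟨y, hy, hyi⟩ := hpred i z h
        simp only [hl z h.le]
        exact (hrun.1 y z hy hyi).1
    · rcases lt_or_ge z i with h | h
      · have h' : z' ≤ i := by rw [Fin.lt_def] at h; rw [Fin.le_def]; omega
        simp only [hr z h.le, hr z' h']
        exact (hstep z z' hz h').2
      · have h' : i ≤ z' := by rw [Fin.le_def] at *; omega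
        simp only [hl z h, hl z' h']
        exact (hrun.1 z z' hz h).2
    · simp only [hr z (by rw [Fin.le_def]; omega)]
      exact hfirst z hz
    · simp only [hl z (by rw [Fin.le_def]; omega)]
      exact hrun.2 z hz
    · rcases lt_trichotomy z i with h | rfl | h
      · simp only [hr z h.le] at hI
        simpa using hlab' z h _ ⟨I, hI, rfl⟩
      · simp only [le_refl, ↓reduceIte, hi] at hI
        simpa using hcl I hI
      · simp only [hl z h.le] at hI
        exact hlab z h I hI
    · simp only [le_refl, ↓reduceIte, hi]
      exact hx
  · have hmem : ∀ z, trueSub θ ρ (ρ.time i) z ∈ 𝒫 (sub θ) := fun z => Set.sep_subset _ _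
    refine ⟨(hβ ρ i).2 hbi, hF' ρ i (fun z => ⟨_, hmem z⟩) (Subtype.ext hxi)
      ⟨fun z z' hz _ => ⟨locallyOk_trueSub _ _ _ _ _, linked_trueSub _ _ _ _ _ hz⟩,
        fun z hz => lastOk_trueSub _ _ _ _ hz⟩ (fun z _ => claimed_trueSub _ _ _ _),
      hP' ρ i (fun z => ⟨_, hmem z⟩) (Subtype.ext hxi)
      (fun z z' hz _ => ⟨locallyOk_trueSub _ _ _ _ _, linked_trueSub _ _ _ _ _ hz⟩)
      (fun z hz => firstOk_trueSub _ _ _ _ hz) (fun z _ => ?_)⟩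
    change IntInterval.neg '' claimed _ = _
    rw [claimed_trueSub]
    ext I
    constructor
    · rintro ⟨J, ⟨h1, h2⟩, rfl⟩
      exact ⟨⟨J, h1, rfl⟩, by simpa using h2⟩
    · rintro ⟨⟨J, h1, rfl⟩, h2⟩
      exact ⟨J, ⟨h1, by simpa using h2⟩, rfl⟩
  · have h1 := hFs.trans (runSize_le hn hm hcard)
    have h2 := hPs.trans (runSize_le hn' hm hcard)
    simp only [PnEMTL.size]
    omega

/-- The translation of `x.θ`: the disjunction of the formulae of `exists_typeFormula` over all
consistent pairs of a label and a letter. -/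
theorem exists_equiv_freeze {θ : TPTL AP} (hθ : θ.FreezeFree) :
    ∃ α : PnEMTL AP, (∀ ρ i, PnEMTL.Sat ρ α i ↔ Sat ρ θ i (ρ.time i)) ∧
      α.size ≤ 2 ^ (2 * θ.size ^ 2 + 7 * θ.size + 11) ∧
      α.AllModalities (ModalityOk θ.intervals) (ModalityOk (IntInterval.neg '' θ.intervals)) := by
  set N := θ.size with hN
  set m := θ.props.length with hm
  set a : Fin m → AP := θ.props.get with ha
  have hmN : m ≤ N := θ.length_props_le
  have ha' : ∀ p ∈ θ.props, ∃ j, a j = p := fun p hp => List.mem_iff_get.1 hp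
  have : Finite (𝒫 (sub θ)) := θ.sub_finite.finite_subsets.to_subtype
  have h := fun d : {d : 𝒫 (sub θ) × Set (Fin m) // θ ∈ d.1.1 ∧ LocallyOk a d.1.1 d.2 ∧
    ∀ I ∈ claimed d.1.1, (0 : ℝ) ∈ I.carrier} => exists_typeFormula hθ a ha' le_rfl hmN d.1.1 d.1.2
      d.2.1 d.2.2.1 d.2.2.2
  choose f h1 h2 h3 h4 using h
  obtain ⟨α, hα, hs, hmod⟩ := PnEMTL.exists_disj (modalityOk_zero _) f h3 h4
  refine ⟨α, fun ρ i => (hα ρ i).trans ⟨fun ⟨d, hd⟩ => h1 d ρ i hd, fun h => ?_⟩,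
    hs.trans ?_, hmod⟩
  · refine ⟨⟨⟨⟨trueSub θ ρ (ρ.time i) i, Set.sep_subset _ _⟩, ρ.letterOn a i⟩,
      ⟨self_mem_sub θ, h⟩, locallyOk_trueSub _ _ _ _ _, fun I hI => ?_⟩, h2 _ ρ i rfl rfl⟩
    simp only [claimed_trueSub, sub_self] at hI
    exact hI.2
  · have hcard : Nat.card {d : 𝒫 (sub θ) × Set (Fin m) // θ ∈ d.1.1 ∧ LocallyOk a d.1.1 d.2 ∧
        ∀ I ∈ claimed d.1.1, (0 : ℝ) ∈ I.carrier} ≤ 2 ^ N * 2 ^ N := by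
      refine (Finite.card_subtype_le _).trans ?_
      rw [Nat.card_prod, Nat.card_coe_set_eq, Set.ncard_powerset _ θ.sub_finite]
      refine Nat.mul_le_mul (Nat.pow_le_pow_right two_pos θ.ncard_sub_le) ?_
      simpa using Nat.pow_le_pow_right two_pos hmN
    set E := 2 * N ^ 2 + 5 * N + 8 with hE
    have hlt : N < 2 ^ N := Nat.lt_two_pow_self
    have h5 : 2 ^ N * 2 ^ 8 ≤ 2 ^ E := by
      rw [← pow_add]; exact Nat.pow_le_pow_right two_pos (by omega)
    calc _ ≤ 2 ^ N * 2 ^ N * (m * 7 + 3 + 2 * 2 ^ E + 2 + 4) + 2 := by gcongr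
      _ ≤ 2 ^ N * 2 ^ N * (2 ^ E * 4) := by
        have h6 : m * 7 + 3 + 2 * 2 ^ E + 2 + 4 + 2 ≤ 2 ^ E * 4 := by omega
        have h7 : 1 ≤ 2 ^ N * 2 ^ N := Nat.one_le_iff_ne_zero.2 (by positivity)
        calc _ ≤ 2 ^ N * 2 ^ N * (m * 7 + 3 + 2 * 2 ^ E + 2 + 4) + 2 ^ N * 2 ^ N * 2 :=
              Nat.add_le_add_left (by omega) _
          _ = 2 ^ N * 2 ^ N * (m * 7 + 3 + 2 * 2 ^ E + 2 + 4 + 2) := by ring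
          _ ≤ _ := Nat.mul_le_mul_left _ h6
      _ = 2 ^ (2 * N ^ 2 + 7 * N + 10) := by rw [hE]; ring
      _ ≤ _ := Nat.pow_le_pow_right two_pos (by omega)

end TPTL

end TimedLogic

theorem mainTheorem3 : ∃ c : Polynomial ℕ, ∀ (AP : Type*) [Finite AP]
    (φ : TimedLogic.TPTL AP), φ.IsSimple →
    ∃ α : TimedLogic.PnEMTL AP,
      (∀ (ρ : TimedLogic.TimedWord AP) (i : Fin ρ.len) (ν : ℝ),
        TimedLogic.TPTL.Sat ρ φ i ν ↔ TimedLogic.PnEMTL.Sat ρ α i) ∧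
      α.size ≤ 2 ^ c.eval φ.size ∧
      α.ArityLE (2 * φ.intervals.ncard ^ 2 + 1) ∧
      α.FutIntervals (fun J =>
        (J.inf = 0 ∨ ∃ I ∈ φ.intervals, I.inf = J.inf) ∧
        (J.sup = 0 ∨ ∃ I ∈ φ.intervals, I.sup = J.sup)) ∧
      α.PastIntervals (fun J =>
        (J.inf = 0 ∨ ∃ I ∈ φ.intervals, I.sup = -J.inf) ∧
        (J.sup = 0 ∨ ∃ I ∈ φ.intervals, I.inf = -J.sup)) ∧
      (φ.IsPosNonAdjacent → α.IsPosNonAdjacent) ∧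
      (φ.IsNegNonAdjacent → α.IsNegNonAdjacent) := by
  refine ⟨2 * Polynomial.X ^ 2 + 7 * Polynomial.X + 10, fun AP _ φ hφ => ?_⟩
  obtain ⟨θ, rfl, hθ⟩ := hφ
  obtain ⟨α, h1, h2, h3⟩ := TimedLogic.TPTL.exists_equiv_freeze hθ
  have hscope := hθ.scopeIntervals_eq
  have hneg : (TimedLogic.IntInterval.neg '' θ.intervals).ncard ≤ θ.intervals.ncard :=
    Set.ncard_image_le θ.intervals_finite
  have harity : θ.intervals.ncard ≤ θ.intervals.ncard ^ 2 := Nat.le_self_pow two_ne_zero _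
  refine ⟨α, fun ρ i ν => (h1 ρ i).symm, h2.trans ?_, ?_, ?_, ?_, fun h => ?_, fun h => ?_⟩
  · refine Nat.pow_le_pow_right two_pos ?_
    simp only [TimedLogic.TPTL.size, Polynomial.eval_add, Polynomial.eval_mul,
      Polynomial.eval_pow, Polynomial.eval_X, Polynomial.eval_ofNat]
    nlinarith
  · refine h3.mono (fun k I h => ?_) (fun k I h => ?_)
    · have := h.1
      simp only [TimedLogic.TPTL.intervals]
      omega
    · have := h.1
      simp only [TimedLogic.TPTL.intervals]
      omega
  · exact h3.mono (fun k I h => h.2) (fun _ _ _ => trivial)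
  · refine h3.mono (fun _ _ _ => trivial) (fun k I h w => (h.2 w).imp ?_ ?_)
    · refine Or.imp_right ?_
      rintro ⟨_, ⟨J, hJ, rfl⟩, hI⟩
      exact ⟨J, hJ, by rw [← hI, TimedLogic.IntInterval.inf_neg, neg_neg]⟩
    · refine Or.imp_right ?_
      rintro ⟨_, ⟨J, hJ, rfl⟩, hI⟩
      exact ⟨J, hJ, by rw [← hI, TimedLogic.IntInterval.sup_neg, neg_neg]⟩
  · have h' := h.1
    rw [hscope] at h'
    exact h3.mono (fun k I hI w w' => (hI.2 w).nonAdjacent h' (hI.2 w')) (fun _ _ _ => trivial)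
  · have h' := h.1
    rw [hscope] at h'
    refine h3.mono (fun _ _ _ => trivial) (fun k I hI w w' =>
      (hI.2 w).nonAdjacent ?_ (hI.2 w'))
    rintro _ ⟨J, hJ, rfl⟩ _ ⟨J', hJ', rfl⟩
    exact (h' J hJ J' hJ').neg
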